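/- Let $p$ be a prime number, $f(x)\in\mathbb Z[x]$ a monic irreducible polynomial, $\theta$ a root of $f$, $K=\mathbb Q(\theta)$, and $\mathbb Z_K$ the ring of integers of $K$. Let $\phi_1,\dots,\phi_t\in\mathbb Z[x]$ be monic polynomials whose reductions modulo $p$ are the different monic irreducible factors of $\bar f\in\mathbb F_p[x]$, put $m_i=\deg\phi_i$, and let $\ell_i\ge 1$ be the exponent of $\bar\phi_i$ in the factorization of $\bar f$. For $\phi=\phi_i$ define $q_0=f$ and, for $j\ge 0$, let $q_{j+1}$ and $a_j$ be the quotient and the remainder of the division of $q_j$ by $\phi$, so that $f=\sum_j a_j\phi^j$ with $\deg a_j<\deg\phi$. Let $u_j=v_p(a_j)\in\mathbb Z_{\ge0}\cup\{\infty\}$ be the minimum of the $p$-adic valuations of the coefficients of $a_j$. Let $N_\phi(f)$ be the lower convex envelope of the points $(j,u_j)$ with $u_j<\infty$, and let the principal polygon $N_\phi^-(f)$ be the part of it over the abscissas $0\le x\le \ell_i$; its sides are the sides of negative slope of $N_\phi(f)$. (If $f=\phi$, then $N_\phi(f)$ is the single point $(1,0)$ and there are no sides.) Let $\mathbb F_\phi=\mathbb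 F_p[x]/(\bar\phi)$ and, for $0\le j\le\ell_i$, let $c_j\in\mathbb F_\phi$ be the class of $a_j/p^{u_j}$ if $(j,u_j)$ lies on $N_\phi^-(f)$, and $c_j=0$ otherwise. The residual polynomial of a side of $N_\phi^-(f)$ with slope $-h/e$ ($h,e$ positive and coprime) that lies over the abscissas from $s$ to $s+de$ is $c_s+c_{s+e}y+\cdots+c_{s+de}y^d\in\mathbb F_\phi[y]$. Write $q_{i,j}$ for the quotients $q_j$ attached to $\phi=\phi_i$, and $y_{i,j}$ for the ordinate of the point of $N_{\phi_i}^-(f)$ of abscissa $j$, $1\le j\le\ell_i$. Suppose that $f$ is $p$-regular with respect to $\phi_1,\dots,\phi_t$, that is, for every $i$ the residual polynomial of every side of $N_{\phi_i}^-(f)$ is separable. Then the elements $$\frac{q_{i,j}(\theta)\,\theta^k}{p^{\lfloor y_{i,j}\rfloor}},\qquad 1\le i\le t,\ 1\le j\le \ell_i,\ 0\le k<m_i,$$ form a $p$-integral basis of $\mathbb Z_K$: they all belong to $\mathbb Z_K$, and they are a basis of the $\mathbb Z_{(p)}$-module $\mathbb Z_K\otimes_{\mathbb Z}\mathbb Z_{(p)}\subset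 K$. -/

import Mathlib

open Polynomial

noncomputable section

namespace OreNewton

/-- The reduction modulo `p` of a polynomial with integer coefficients. -/
abbrev reduction (p : ℕ) (g : ℤ[X]) : (ZMod p)[X] := g.map (Int.castRingHom (ZMod p))

/-- The `p`-adic valuation of a polynomial: the minimum of the `p`-adic valuations of its
coefficients, with value `⊤` at the zero polynomial. -/
def polyVal (p : ℕ) (g : ℤ[X]) : ℕ∞ :=
  g.support.inf fun i => emultiplicity (p : ℤ) (g.coeff i)

/-- The quotients attached to the `φ`-adic development of `f`: `q 0 = f`, and `q (j + 1)` is the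
quotient of the division of `q j` by the monic polynomial `φ`. -/
def quot (φ f : ℤ[X]) : ℕ → ℤ[X]
  | 0 => f
  | j + 1 => quot φ f j /ₘ φ

/-- The coefficients of the `φ`-adic development `f = a 0 + a 1 * φ + a 2 * φ ^ 2 + ⋯`: `a j` is
the remainder of the division of `q j` by `φ`. -/
def devCoeff (φ f : ℤ[X]) (j : ℕ) : ℤ[X] := quot φ f j %ₘ φ

/-- `u i = v_p (a i)`, the `p`-adic valuation of the `i`-th coefficient of the `φ`-adic
development of `f`. -/
def devVal (p : ℕ) (φ f : ℤ[X]) (i : ℕ) : ℕ∞ := polyVal p (devCoeff φ f i)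

/-- The points `(i, u i)` of the plane with `u i < ∞`. -/
def cloud (p : ℕ) (φ f : ℤ[X]) : Set (ℝ × ℝ) :=
  {P | ∃ i u : ℕ, devVal p φ f i = (u : ℕ∞) ∧ P = ((i : ℝ), (u : ℝ))}

/-- The `φ`-Newton polygon of `f`, which is the lower convex envelope of the points `(i, u i)`,
given as a function: `ordinate p φ f x` is the ordinate of its point of abscissa `x`.
When `f` is monic and `φ` is irreducible modulo `p`, the principal polygon (the
sides of negative slope) is the part of this polygon that lies over the abscissas from `0` to
the order of `φ` modulo `p` in `f` modulo `p`, so there this is also the ordinate on the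
principal polygon. -/
def ordinate (p : ℕ) (φ f : ℤ[X]) (x : ℝ) : ℝ :=
  sInf {y : ℝ | (x, y) ∈ convexHull ℝ (cloud p φ f)}

/-- `IsSide p φ f s t lam`: the segment that joins `(s, u s)` to `(t, u t)`, `s < t`, is a side
of the `φ`-Newton polygon of `f`, and `lam` is its slope. That is: no point `(i, u i)` lies below
the line through these two points, and every point `(i, u i)` on that line has
an abscissa between `s` and `t`. -/
def IsSide (p : ℕ) (φ f : ℤ[X]) (s t : ℕ) (lam : ℚ) : Prop :=
  s < t ∧ ∃ us ut : ℕ, devVal p φ f s = (us : ℕ∞) ∧ devVal p φ f t = (ut : ℕ∞) ∧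
    lam = ((ut : ℚ) - us) / ((t : ℚ) - s) ∧
    ∀ i u : ℕ, devVal p φ f i = (u : ℕ∞) →
      (us : ℚ) + lam * ((i : ℚ) - s) ≤ u ∧
      ((u : ℚ) = us + lam * ((i : ℚ) - s) → s ≤ i ∧ i ≤ t)

/-- The finite field `F_φ = ℤ_p[x] / (p, φ) = 𝔽_p[x] / (φ mod p)`. -/
abbrev ResidueRing (p : ℕ) (φ : ℤ[X]) : Type := AdjoinRoot (reduction p φ)

/-- The polynomial `g / p ^ u`, for `g` with all coefficients divisible by `p ^ u`. -/
def divPow (p u : ℕ) (g : ℤ[X]) : ℤ[X] :=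
  ∑ k ∈ g.support, monomial k (g.coeff k / (p : ℤ) ^ u)

open scoped Classical in
/-- The residual coefficient `c i`: the class of `a i / p ^ (u i)` in `F_φ` if `(i, u i)` lies on
the Newton polygon, and `0` if it lies strictly above it or if `u i = ∞`. -/
def residualCoeff (p : ℕ) (φ f : ℤ[X]) (i : ℕ) : ResidueRing p φ :=
  if devVal p φ f i ≠ ⊤ ∧ ((devVal p φ f i).toNat : ℝ) = ordinate p φ f i then
    AdjoinRoot.mk (reduction p φ)
      (reduction p (divPow p (devVal p φ f i).toNat (devCoeff φ f i)))
  else 0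

/-- The residual polynomial `c s + c (s + e) y + ⋯ + c (s + d e) y ^ d` attached to a side from
abscissa `s` to abscissa `t` of slope `lam = - h / e` in lowest terms; `d = (t - s) / e` is the
degree of the side. -/
def residualPoly (p : ℕ) (φ f : ℤ[X]) (s t : ℕ) (lam : ℚ) : (ResidueRing p φ)[X] :=
  ∑ k ∈ Finset.range ((t - s) / lam.den + 1),
    monomial k (residualCoeff p φ f (s + k * lam.den))

/-- `f` is `φ`-regular: the residual polynomial of every side of negative slope of the `φ`-Newton
polygon of `f` is separable. -/
def IsPhiRegular (p : ℕ) (φ f : ℤ[X]) : Prop :=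
  ∀ (s t : ℕ) (lam : ℚ), IsSide p φ f s t lam → lam < 0 → (residualPoly p φ f s t lam).Separable

/-- `φ 1, …, φ t` are monic polynomials with integer coefficients whose reductions modulo `p` are
the different monic irreducible factors of the reduction of `f` modulo `p`. -/
structure IsFactorLift (p : ℕ) (f : ℤ[X]) {t : ℕ} (φ : Fin t → ℤ[X]) : Prop where
  monic : ∀ i, (φ i).Monic
  injective : Function.Injective fun i => reduction p (φ i)
  range_eq : Set.range (fun i => reduction p (φ i)) =
    {g : (ZMod p)[X] | g.Monic ∧ Irreducible g ∧ g ∣ reduction p f}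

/-- `f` is `p`-regular with respect to the choice `φ 1, …, φ t` of lifts. -/
def IsRegular (p : ℕ) (f : ℤ[X]) {t : ℕ} (φ : Fin t → ℤ[X]) : Prop :=
  ∀ i, IsPhiRegular p (φ i) f

/-- The exponent of `φ` modulo `p` in the factorization of `f` modulo `p`. -/
def ord (p : ℕ) (φ f : ℤ[X]) : ℕ := multiplicity (reduction p φ) (reduction p f)

/-- The local ring `ℤ_(p)` of the rational numbers with denominator prime to `p`. -/
abbrev localInt (p : ℕ) [Fact p.Prime] : Subring ℚ := (Rat.padicValuation p).integer

/-- A family of elements of a number field `K` is a `p`-integral basis of the ring of integers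
`Z_K`: its members lie in `Z_K`, and it is a basis of the `ℤ_(p)`-module
`Z_K ⊗ ℤ_(p)`, identified with the `ℤ_(p)`-submodule of `K` spanned by `Z_K`. -/
structure IsPIntegralBasis (p : ℕ) [Fact p.Prime] {K : Type*} [Field K] [NumberField K]
    {ι : Type*} (b : ι → K) : Prop where
  integral : ∀ i, IsIntegral ℤ (b i)
  linearIndependent : LinearIndependent (localInt p) b
  span_eq : Submodule.span (localInt p) (Set.range b) =
    Submodule.span (localInt p) {x : K | IsIntegral ℤ x}

end OreNewton

end

/-!
The elements of the family are integral because of a supporting line of the polygon at the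
abscissa `j`, of slope `- h / e`. Modulo `f`, the product `φ ^ j * q j` is both the end and minus
the beginning of the `φ`-adic development of `f`. For a valuation `v` of `K` that is nonnegative on
the integers, the end bounds `v (q j (θ))` from below when `e * v (φ (θ)) ≥ h * v p`, the beginning
when `e * v (φ (θ)) ≤ h * v p`, and in both cases the bound is the ordinate at `j` times `v p`
(`valuation_quot_le`).

There are `∑ ℓ_i * deg φ_i = deg f` elements, so it is enough that an integral combination of them
lying in `p * Z_K` has all its coefficients divisible by `p` (`isPIntegralBasis_of_forall_dvd`).
This is `reduction_eq_zero_of_isIntegral`, and it needs no knowledge of the prime ideals over `p`.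
A side of slope `- h / e` of the polygon attached to `φ = φ_i` defines a valuation of `ℤ[x]`, with
values `e` at `p` and `h` at `φ`, and residual polynomials. Both are realised by a ring homomorphism
from `ℤ[x]` to a ring in which `p = ϖ ^ e` and `φ = ϖ ^ h * Θ`, and whose quotient by `ϖ` is the
polynomial ring `F_φ[T]` (`SlopeModel`), and so they are multiplicative. Suppose that
`p * z = ∑ A_{i,j}(θ) * q_{i,j}(θ) / p ^ ⌊y_{i,j}⌋` with `z` integral and some `A_{i,j}` nonzero
modulo `p`. Fix such an `i`, take among these `j` the ones for which the fractional part of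
`y_{i,j}` is least, let `j₀` be the largest of them, and consider the side over `j₀`. After
multiplication by `∏ φ_{i'} ^ ℓ_{i'}`, every summand has a representative modulo `f`, given by the
end or by the beginning of a development, such that only the summands with least fractional part
and abscissa over the side contribute to the initial form of the sum. This initial form is, up to
powers of the variable `U`, a polynomial `G (U ^ e)`, where `G` is a combination of proper tails of
the residual polynomial `R` of the side; thus `G ≠ 0` and `deg G < deg R`
(`not_tailPoly_dvd_sum`). The integral equation of `z` is a congruence modulo `f`, whose initial
form says that `R (U ^ e)` divides a power of `G (U ^ e)` times a power of `U`
(`SlopeModel.residual_dvd_pow`). As `R` is separable with `R 0 ≠ 0`, it divides `G`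
(`dvd_of_comp_dvd_pow`), a contradiction.
-/

noncomputable section

namespace OreNewton

/-! ### Rings that realise the valuation of a slope -/

/-- The ring homomorphism `ρ` is the reduction modulo the nonzerodivisor `ϖ`: it is surjective
and its kernel is generated by `ϖ`. -/
structure IsReductionMod {R k : Type*} [CommRing R] [CommRing k] (ρ : R →+* k) (ϖ : R) : Prop where
  surjective : Function.Surjective ρ
  regular : ∀ x, ϖ * x = 0 → x = 0
  map_eq_zero_iff : ∀ x, ρ x = 0 ↔ ϖ ∣ x

namespace IsReductionMod

variable {R k : Type*} [CommRing R] [CommRing k] {ρ : R →+* k} {ϖ : R}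

lemma map_self (H : IsReductionMod ρ ϖ) : ρ ϖ = 0 := (H.map_eq_zero_iff ϖ).2 dvd_rfl

lemma pow_regular (H : IsReductionMod ρ ϖ) (n : ℕ) {x y : R} (h : ϖ ^ n * x = ϖ ^ n * y) :
    x = y := by
  induction n with
  | zero => simpa using h
  | succ n ih =>
    apply ih
    have : ϖ * (ϖ ^ n * x - ϖ ^ n * y) = 0 := by linear_combination h
    exact sub_eq_zero.1 (H.regular _ this)

lemma pow_dvd_of_pow_dvd_mul [IsDomain k] (H : IsReductionMod ρ ϖ) {F g : R} (hF : ρ F ≠ 0)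
    (n : ℕ) (h : ϖ ^ n ∣ F * g) : ϖ ^ n ∣ g := by
  induction n generalizing g with
  | zero => simp
  | succ n ih =>
    have h1 : ϖ ∣ F * g := (dvd_pow_self ϖ (Nat.succ_ne_zero n)).trans h
    have h2 : ρ g = 0 := by
      have := (H.map_eq_zero_iff _).2 h1
      rw [map_mul] at this
      exact (mul_eq_zero.1 this).resolve_left hF
    obtain ⟨g', rfl⟩ := (H.map_eq_zero_iff _).1 h2
    obtain ⟨z, hz⟩ := h
    have h3 : F * g' = ϖ ^ n * z := by
      apply H.pow_regular 1
      linear_combination hz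
    obtain ⟨w, hw⟩ := ih ⟨z, h3⟩
    exact ⟨w, by rw [hw]; ring⟩

lemma polynomial (H : IsReductionMod ρ ϖ) : IsReductionMod (mapRingHom ρ) (C ϖ) where
  surjective := map_surjective ρ H.surjective
  regular x hx := by
    ext n
    have := congrArg (fun q => coeff q n) hx
    simp only [coeff_C_mul, coeff_zero] at this
    simpa using H.regular _ this
  map_eq_zero_iff x := by
    rw [C_dvd_iff_dvd_coeff, Polynomial.ext_iff]
    simp [H.map_eq_zero_iff]

lemma adjoinRoot (H : IsReductionMod ρ ϖ) {g : R[X]} (hg : g.Monic) {q : k[X]}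
    (hq : g.map ρ = q) :
    IsReductionMod (AdjoinRoot.map ρ g q (hq ▸ dvd_rfl)) (AdjoinRoot.of g ϖ) := by
  have key (P : R[X]) : AdjoinRoot.map ρ g q (hq ▸ dvd_rfl) (AdjoinRoot.mk g P) =
      AdjoinRoot.mk q (P.map ρ) := by
    induction P using Polynomial.induction_on' with
    | add a b ha hb => simp only [map_add, ha, hb, Polynomial.map_add]
    | monomial n a =>
      rw [← C_mul_X_pow_eq_monomial]
      simp
  subst hq
  refine ⟨fun y => ?_, fun x hx => ?_, fun x => ⟨fun hx => ?_, ?_⟩⟩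
  · obtain ⟨Q, rfl⟩ := AdjoinRoot.mk_surjective y
    obtain ⟨P, rfl⟩ := map_surjective ρ H.surjective Q
    exact ⟨AdjoinRoot.mk g P, key P⟩
  · obtain ⟨P, rfl⟩ := AdjoinRoot.mk_surjective x
    rw [← AdjoinRoot.mk_C, ← map_mul, AdjoinRoot.mk_eq_zero, ← smul_eq_C_mul,
      ← modByMonic_eq_zero_iff_dvd hg, smul_modByMonic, smul_eq_C_mul] at hx
    rw [AdjoinRoot.mk_eq_zero, ← modByMonic_eq_zero_iff_dvd hg]
    exact H.polynomial.regular _ hx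
  · obtain ⟨P, rfl⟩ := AdjoinRoot.mk_surjective x
    rw [key, AdjoinRoot.mk_eq_zero] at hx
    obtain ⟨Q', hQ'⟩ := hx
    obtain ⟨Q, rfl⟩ := map_surjective ρ H.surjective Q'
    obtain ⟨Z, hZ⟩ := (H.polynomial.map_eq_zero_iff (P - g * Q)).1 (by simp [hQ'])
    refine ⟨AdjoinRoot.mk g Z, ?_⟩
    rw [← AdjoinRoot.mk_C, ← map_mul, ← hZ]
    simp
  · rintro ⟨y, rfl⟩
    rw [map_mul, AdjoinRoot.map_of, H.map_self, map_zero, zero_mul]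

end IsReductionMod

/-- The ring `ℤ[ϖ]`, with `ϖ ^ e = p`, reduces modulo `ϖ` to `ℤ / p`. -/
lemma exists_ramified_base (p e : ℕ) [Fact p.Prime] (he : 0 < e) :
    ∃ (ρ : AdjoinRoot (X ^ e - C (p : ℤ)) →+* ZMod p),
      IsReductionMod ρ (AdjoinRoot.root (X ^ e - C (p : ℤ))) := by
  have hp : (p : ℤ) ≠ 0 := by exact_mod_cast (Fact.out : p.Prime).ne_zero
  set g : ℤ[X] := X ^ e - C (p : ℤ) with hgdef
  have hg : g.Monic := monic_X_pow_sub_C _ he.ne'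
  have hroot : AdjoinRoot.root g ^ e = (p : AdjoinRoot g) := by
    have := AdjoinRoot.eval₂_root g
    simpa [hgdef, sub_eq_zero] using this
  refine ⟨AdjoinRoot.lift (Int.castRingHom (ZMod p)) 0 (by simp [hgdef, he.ne']), ?_, ?_, ?_⟩
  · intro y
    obtain ⟨n, rfl⟩ := ZMod.intCast_surjective y
    exact ⟨(n : AdjoinRoot g), by simp⟩
  · intro x hx
    have h1 : (p : AdjoinRoot g) * x = 0 := by
      rw [← hroot]
      obtain ⟨k, rfl⟩ : ∃ k, e = k + 1 := ⟨e - 1, by omega⟩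
      rw [pow_succ, mul_assoc, hx, mul_zero]
    obtain ⟨P, rfl⟩ := AdjoinRoot.mk_surjective x
    have h2 : AdjoinRoot.mk g ((p : ℤ) • P) = 0 := by
      rw [smul_eq_C_mul, map_mul, ← h1]; simp
    rw [AdjoinRoot.mk_eq_zero, ← modByMonic_eq_zero_iff_dvd hg, smul_modByMonic] at h2
    rw [AdjoinRoot.mk_eq_zero, ← modByMonic_eq_zero_iff_dvd hg]
    exact (smul_eq_zero.1 h2).resolve_left hp
  · intro x
    constructor
    · intro hx
      obtain ⟨P, rfl⟩ := AdjoinRoot.mk_surjective x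
      rw [AdjoinRoot.lift_mk] at hx
      have h0 : (p : ℤ) ∣ P.coeff 0 := by
        rw [eval₂_at_zero] at hx
        exact (ZMod.intCast_zmod_eq_zero_iff_dvd _ _).1 hx
      obtain ⟨m, hm⟩ := h0
      rw [← divX_mul_X_add P, hm]
      simp only [map_add, map_mul, AdjoinRoot.mk_X, AdjoinRoot.mk_C]
      apply dvd_add (dvd_mul_left _ _)
      have : (AdjoinRoot.of g) ((p : ℕ) : ℤ) = (p : AdjoinRoot g) := by simp
      rw [this, ← hroot]
      exact (dvd_pow_self _ he.ne').mul_right _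
    · rintro ⟨y, rfl⟩
      rw [map_mul, AdjoinRoot.lift_root, zero_mul]

/-- A ring in which `p = ϖ ^ e` and `φ = ϖ ^ h * Θ`, whose reduction modulo `ϖ` is the polynomial
ring over the residue field `F_φ`, with `Θ` reducing to a nonzero multiple of the variable. The
`ϖ`-adic order of `ι g` is the valuation of `g` with `v p = e`, `v φ = h` and `v a = e * v_p a`
for `deg a < deg φ`, and the reduction of `ι g` divided by this power of `ϖ` is the residual
polynomial of `g`. Being a ring homomorphism, `ι` makes both multiplicative. -/
structure SlopeModel (p : ℕ) (φ : ℤ[X]) (e h : ℕ) where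
  /-- the underlying ring -/
  S : Type
  /-- its ring structure -/
  [ring : CommRing S]
  /-- the root of `p` of degree `e` -/
  ϖ : S
  /-- the homomorphism from the integer polynomials -/
  ι : ℤ[X] →+* S
  /-- the reduction modulo `ϖ` -/
  ρ : S →+* (ResidueRing p φ)[X]
  /-- the quotient of `φ` by `ϖ ^ h` -/
  Θ : S
  /-- the coefficient of the variable in the reduction of `Θ`, which is the class of the derivative
  of `φ` -/
  c : ResidueRing p φ
  isReductionMod : IsReductionMod ρ ϖ
  ι_prime : ι (C (p : ℤ)) = ϖ ^ e
  ι_phi : ι φ = ϖ ^ h * Θ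
  c_ne_zero : c ≠ 0
  ρ_Theta : ρ Θ = C c * X
  ρ_ι : ∀ g, ρ (ι g) = C (AdjoinRoot.mk (reduction p φ) (reduction p g))

attribute [instance] SlopeModel.ring

/-- Slope models exist: adjoin to `ℤ` a root `ϖ` of `p` of degree `e` and a root `α` of `φ`, and
send `x` to `α + ϖ ^ h * T`. -/
theorem SlopeModel.exists {p e h : ℕ} [Fact p.Prime] {φ : ℤ[X]} (hφ : φ.Monic)
    (hirr : Irreducible (reduction p φ)) (he : 0 < e) (hh : 0 < h) :
    Nonempty (SlopeModel p φ e h) := by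
  obtain ⟨ρ₀, H₀⟩ := exists_ramified_base p e he
  set B := AdjoinRoot (X ^ e - C (p : ℤ)) with hB
  set ϖ₀ : B := AdjoinRoot.root (X ^ e - C (p : ℤ)) with hϖ₀
  have hroot : ϖ₀ ^ e = (p : B) := by
    have := AdjoinRoot.eval₂_root (X ^ e - C (p : ℤ))
    simpa [sub_eq_zero] using this
  set φB : B[X] := φ.map (Int.castRingHom B) with hφB
  have hφBm : φB.Monic := hφ.map _
  have hred : φB.map ρ₀ = reduction p φ := by
    rw [hφB, Polynomial.map_map]
    congr 1
    exact RingHom.ext_int _ _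
  have H₁ := H₀.adjoinRoot hφBm hred
  set ρ₁ := AdjoinRoot.map ρ₀ φB (reduction p φ) (hred ▸ dvd_rfl) with hρ₁
  set A := AdjoinRoot φB with hA
  set ϖ₁ : A := AdjoinRoot.of φB ϖ₀ with hϖ₁
  set α : A := AdjoinRoot.root φB with hα
  have H := H₁.polynomial
  have hφα : eval₂ (Int.castRingHom A[X]) (C α) φ = 0 := by
    have h1 := AdjoinRoot.eval₂_root φB
    rw [hφB, eval₂_map] at h1
    have h2 := congrArg (C : A →+* A[X]) h1
    rw [hom_eval₂, map_zero] at h2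
    rw [← h2]
    congr 1
  have hρα : (mapRingHom ρ₁) (C α) = C (AdjoinRoot.root (reduction p φ)) := by
    simp [hρ₁, hα]
  have hconst (g : ℤ[X]) (x : A[X]) (hx : (mapRingHom ρ₁) x =
      C (AdjoinRoot.root (reduction p φ))) :
      (mapRingHom ρ₁) (eval₂ (Int.castRingHom A[X]) x g) =
        C (AdjoinRoot.mk (reduction p φ) (reduction p g)) := by
    rw [hom_eval₂, hx, ← AdjoinRoot.aeval_eq, aeval_def, eval₂_map, hom_eval₂]
    congr 1
    exact RingHom.ext_int _ _
  set x : A[X] := C α + C ϖ₁ ^ h * X with hx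
  have hρx : (mapRingHom ρ₁) x = C (AdjoinRoot.root (reduction p φ)) := by
    rw [hx, map_add, map_mul, map_pow, H.map_self, hρα, zero_pow hh.ne', zero_mul, add_zero]
  obtain ⟨w, hw⟩ := (φ.map (Int.castRingHom A[X])).binomExpansion (C α) (C ϖ₁ ^ h * X)
  rw [← hx, derivative_map, eval_map, eval_map, eval_map, hφα, zero_add] at hw
  have : Fact (Irreducible (reduction p φ)) := ⟨hirr⟩
  refine ⟨{
    S := A[X]
    ϖ := C ϖ₁
    ι := eval₂RingHom (Int.castRingHom A[X]) x
    ρ := mapRingHom ρ₁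
    Θ := eval₂ (Int.castRingHom A[X]) (C α) (derivative φ) * X + w * C ϖ₁ ^ h * X ^ 2
    c := AdjoinRoot.mk (reduction p φ) (reduction p (derivative φ))
    isReductionMod := H
    ι_prime := ?_
    ι_phi := ?_
    c_ne_zero := ?_
    ρ_Theta := ?_
    ρ_ι := fun g => hconst g x hρx }⟩
  · rw [coe_eval₂RingHom, eval₂_C, ← C_pow, hϖ₁, ← map_pow, hroot]
    simp
  · rw [coe_eval₂RingHom, hw]
    ring
  · rw [Ne, AdjoinRoot.mk_eq_zero]
    intro hdvd
    have hsep : (reduction p φ).Separable := PerfectField.separable_of_irreducible hirr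
    have h1 : IsCoprime (reduction p φ) (reduction p (derivative φ)) := by
      have := hsep
      rw [separable_def, derivative_map] at this
      exact this
    exact hirr.not_isUnit (h1.isUnit_of_dvd' dvd_rfl hdvd)
  · rw [map_add, map_mul, map_mul, map_mul, hconst _ _ hρα, map_pow, H.map_self,
      zero_pow hh.ne']
    simp

/-! ### Valuations of polynomials and developments -/

lemma le_polyVal_iff {p : ℕ} {g : ℤ[X]} {n : ℕ} :
    (n : ℕ∞) ≤ polyVal p g ↔ ∀ k, (p : ℤ) ^ n ∣ g.coeff k := by
  rw [polyVal, Finset.le_inf_iff]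
  simp only [← pow_dvd_iff_le_emultiplicity]
  refine ⟨fun h k => ?_, fun h k _ => h k⟩
  by_cases hk : g.coeff k = 0
  · simp [hk]
  · exact h k (mem_support_iff.2 hk)

lemma polyVal_zero (p : ℕ) : polyVal p 0 = ⊤ := by simp [polyVal]

lemma polyVal_eq_top_iff {p : ℕ} [Fact p.Prime] {g : ℤ[X]} : polyVal p g = ⊤ ↔ g = 0 := by
  refine ⟨fun h => ?_, fun h => h ▸ polyVal_zero p⟩
  rw [polyVal, Finset.inf_eq_top_iff] at h
  by_contra hg
  obtain ⟨k, hk⟩ := nonempty_support_iff.2 hg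
  have h1 : FiniteMultiplicity (p : ℤ) (g.coeff k) :=
    Int.finiteMultiplicity_iff.2
      ⟨by simpa using (Fact.out : p.Prime).ne_one, mem_support_iff.1 hk⟩
  exact (finiteMultiplicity_iff_emultiplicity_ne_top.1 h1) (h k hk)

lemma coeff_divPow (p u : ℕ) (g : ℤ[X]) (k : ℕ) :
    (divPow p u g).coeff k = g.coeff k / (p : ℤ) ^ u := by
  rw [divPow, finsetSum_coeff]
  simp only [coeff_monomial]
  rw [Finset.sum_ite_eq' g.support k]
  split_ifs with h
  · rfl
  · rw [notMem_support_iff.1 h, Int.zero_ediv]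

lemma degree_divPow_le (p u : ℕ) (g : ℤ[X]) : (divPow p u g).degree ≤ g.degree := by
  refine degree_le_iff_coeff_zero _ _ |>.2 fun k hk => ?_
  rw [coeff_divPow, coeff_eq_zero_of_degree_lt hk, Int.zero_ediv]

/-- The content of `g` at `p` times `g` divided by it, also when `g = 0`. -/
lemma eq_pow_mul_divPow (p : ℕ) (g : ℤ[X]) :
    g = C ((p : ℤ)) ^ (polyVal p g).toNat * divPow p (polyVal p g).toNat g := by
  have h : ((polyVal p g).toNat : ℕ∞) ≤ polyVal p g := ENat.natCast_toNat_le_self _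
  rw [le_polyVal_iff] at h
  ext k
  rw [← C_pow, coeff_C_mul, coeff_divPow, Int.mul_ediv_cancel' (h k)]

lemma reduction_eq_zero_iff {p : ℕ} {g : ℤ[X]} :
    reduction p g = 0 ↔ ∀ k, (p : ℤ) ∣ g.coeff k := by
  rw [Polynomial.ext_iff]
  refine forall_congr' fun k => ?_
  rw [coeff_map, coeff_zero, eq_intCast, ZMod.intCast_zmod_eq_zero_iff_dvd]

lemma one_le_polyVal_iff {p : ℕ} {g : ℤ[X]} : 1 ≤ polyVal p g ↔ reduction p g = 0 := by
  rw [reduction_eq_zero_iff]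
  simpa using le_polyVal_iff (p := p) (g := g) (n := 1)

lemma exists_eq_C_mul_of_reduction_eq_zero {p : ℕ} {g : ℤ[X]} (h : reduction p g = 0) :
    ∃ g' : ℤ[X], g = C (p : ℤ) * g' := by
  rw [reduction_eq_zero_iff] at h
  exact (C_dvd_iff_dvd_coeff _ _).2 h

lemma reduction_divPow_ne_zero {p : ℕ} [Fact p.Prime] {g : ℤ[X]} (hg : g ≠ 0) :
    reduction p (divPow p (polyVal p g).toNat g) ≠ 0 := by
  intro h
  obtain ⟨g', hg'⟩ := exists_eq_C_mul_of_reduction_eq_zero h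
  have h1 := eq_pow_mul_divPow p g
  have htop : polyVal p g ≠ ⊤ := fun h => hg (polyVal_eq_top_iff.1 h)
  have h2 : (((polyVal p g).toNat + 1 : ℕ) : ℕ∞) ≤ polyVal p g := by
    rw [le_polyVal_iff]
    intro k
    have h4 : g = C ((p : ℤ) ^ ((polyVal p g).toNat + 1)) * g' := by
      rw [C_pow, pow_succ, mul_assoc, ← hg', ← h1]
    exact (C_dvd_iff_dvd_coeff _ _).1 ⟨g', h4⟩ k
  have h3 := ENat.natCast_toNat htop
  rw [← h3] at h2
  have h4 : (polyVal p g).toNat + 1 ≤ (polyVal p g).toNat := by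
    rw [ENat.toNat_natCast] at h2
    exact_mod_cast h2
  omega

lemma devVal_ne_top_iff {p : ℕ} [Fact p.Prime] {φ f : ℤ[X]} {l : ℕ} :
    devVal p φ f l ≠ ⊤ ↔ devCoeff φ f l ≠ 0 := not_congr polyVal_eq_top_iff

lemma mk_reduction_ne_zero {p : ℕ} [Fact p.Prime] {φ g : ℤ[X]} (hφ : φ.Monic)
    (hdeg : g.degree < φ.degree) (h : reduction p g ≠ 0) :
    AdjoinRoot.mk (reduction p φ) (reduction p g) ≠ 0 := by
  rw [Ne, AdjoinRoot.mk_eq_zero]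
  intro hdvd
  refine h (eq_zero_of_dvd_of_degree_lt hdvd ?_)
  rw [hφ.degree_map]
  exact degree_map_le.trans_lt hdeg

/-- A nonzero coefficient of the development, divided by its content at `p`, is a unit modulo
`(p, φ)`, since its degree is less than that of `φ`. -/
lemma mk_divPow_devCoeff_ne_zero {p : ℕ} [Fact p.Prime] {φ f : ℤ[X]} (hφ : φ.Monic) {l : ℕ}
    (h : devCoeff φ f l ≠ 0) :
    AdjoinRoot.mk (reduction p φ)
      (reduction p (divPow p (devVal p φ f l).toNat (devCoeff φ f l))) ≠ 0 :=
  mk_reduction_ne_zero hφ ((degree_divPow_le _ _ _).trans_lt (degree_modByMonic_lt _ hφ))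
    (reduction_divPow_ne_zero h)

section Development

variable {φ f : ℤ[X]}

lemma quot_eq_devCoeff_add (φ f : ℤ[X]) (j : ℕ) :
    quot φ f j = devCoeff φ f j + φ * quot φ f (j + 1) := by
  have h : quot φ f (j + 1) = quot φ f j /ₘ φ := by rw [quot]
  rw [h, devCoeff, modByMonic_add_div]

lemma eq_sum_add_pow_mul_quot (φ f : ℤ[X]) (i j : ℕ) :
    quot φ f i = ∑ l ∈ Finset.range j, devCoeff φ f (i + l) * φ ^ l + φ ^ j * quot φ f (i + j) := by
  induction j with
  | zero => simp
  | succ j ih =>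
    rw [ih, Finset.sum_range_succ, quot_eq_devCoeff_add φ f (i + j)]
    rw [add_assoc i j 1]
    ring

lemma quot_eq_zero (hd : 0 < φ.degree) (f : ℤ[X]) {j : ℕ} (hj : f.natDegree < j) :
    quot φ f j = 0 := by
  have key : ∀ j, quot φ f j = 0 ∨ (quot φ f j).natDegree + j ≤ f.natDegree := by
    intro j
    induction j with
    | zero => right; simp [quot]
    | succ j ih =>
      rcases ih with ih | ih
      · left; simp [quot, ih]
      · by_cases h0 : quot φ f (j + 1) = 0
        · exact .inl h0
        · right
          have hq : quot φ f j ≠ 0 := by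
            intro h; exact h0 (by simp [quot, h])
          have : (quot φ f (j + 1)).natDegree < (quot φ f j).natDegree :=
            natDegree_lt_natDegree h0 (degree_divByMonic_lt _ φ hq hd)
          omega
  rcases key j with h | h
  · exact h
  · omega

lemma quot_eq_sum (hd : 0 < φ.degree) (f : ℤ[X]) (j : ℕ) :
    quot φ f j = ∑ l ∈ Finset.range (f.natDegree + 1), devCoeff φ f (j + l) * φ ^ l := by
  rw [eq_sum_add_pow_mul_quot φ f j (f.natDegree + 1), quot_eq_zero hd f (by omega), mul_zero,
    add_zero]

lemma devCoeff_eq_zero (hd : 0 < φ.degree) (f : ℤ[X]) {j : ℕ}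
    (hj : f.natDegree < j) : devCoeff φ f j = 0 := by
  rw [devCoeff, quot_eq_zero hd f hj, zero_modByMonic]

variable {p : ℕ} [Fact p.Prime]

lemma degree_pos_of_irreducible_reduction (hφ : φ.Monic) (hirr : Irreducible (reduction p φ)) :
    0 < φ.degree := by
  rw [← hφ.degree_map (Int.castRingHom (ZMod p))]
  exact degree_pos_of_irreducible hirr

lemma exists_reduction_eq_pow_ord_mul (hf : f.Monic) (hirr : Irreducible (reduction p φ)) :
    ∃ g, reduction p f = reduction p φ ^ ord p φ f * g ∧ ¬ reduction p φ ∣ g := by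
  have : FiniteMultiplicity (reduction p φ) (reduction p f) :=
    FiniteMultiplicity.of_not_isUnit hirr.not_isUnit (hf.map _).ne_zero
  exact this.exists_eq_pow_mul_and_not_dvd

lemma reduction_quot (hφ : φ.Monic) {g : (ZMod p)[X]}
    {n : ℕ} (hg : reduction p f = reduction p φ ^ n * g) {j : ℕ} (hj : j ≤ n) :
    reduction p (quot φ f j) = reduction p φ ^ (n - j) * g := by
  induction j with
  | zero => simpa [quot] using hg
  | succ j ih =>
    rw [quot, reduction, map_divByMonic _ hφ]
    rw [reduction, reduction] at ih
    rw [ih (by omega), show n - j = (n - (j + 1)) + 1 by omega, pow_succ', mul_assoc,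
      mul_divByMonic_cancel_left _ (hφ.map _)]

lemma reduction_devCoeff_of_lt (hf : f.Monic) (hφ : φ.Monic) (hirr : Irreducible (reduction p φ))
    {j : ℕ} (hj : j < ord p φ f) : reduction p (devCoeff φ f j) = 0 := by
  obtain ⟨g, hg, -⟩ := exists_reduction_eq_pow_ord_mul hf hirr
  have := reduction_quot hφ hg hj.le
  rw [devCoeff, reduction, map_modByMonic _ hφ, modByMonic_eq_zero_iff_dvd (hφ.map _)]
  rw [reduction, reduction] at this
  rw [this]
  exact (dvd_pow_self _ (by omega)).mul_right _

lemma one_le_devVal (hf : f.Monic) (hφ : φ.Monic) (hirr : Irreducible (reduction p φ))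
    {j : ℕ} (hj : j < ord p φ f) : 1 ≤ devVal p φ f j :=
  one_le_polyVal_iff.2 (reduction_devCoeff_of_lt hf hφ hirr hj)

lemma devVal_ord (hf : f.Monic) (hφ : φ.Monic) (hirr : Irreducible (reduction p φ)) :
    devVal p φ f (ord p φ f) = 0 := by
  obtain ⟨g, hg, hndvd⟩ := exists_reduction_eq_pow_ord_mul hf hirr
  have := reduction_quot hφ hg le_rfl
  by_contra h
  have h1 : 1 ≤ devVal p φ f (ord p φ f) := Order.one_le_iff_ne_zero.2 h
  rw [devVal, one_le_polyVal_iff, devCoeff, reduction, map_modByMonic _ hφ,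
    modByMonic_eq_zero_iff_dvd (hφ.map _)] at h1
  rw [reduction, reduction] at this
  rw [this] at h1
  simp at h1
  exact hndvd h1

/-- The constant coefficient of the development of an irreducible `f` vanishes only if
`f = φ`. -/
lemma eq_of_devCoeff_zero_eq_zero (hf : f.Monic) (hirr : Irreducible f) (hφ : φ.Monic)
    (hd : 0 < φ.degree) (h : devCoeff φ f 0 = 0) : f = φ := by
  have h1 : φ ∣ f := (modByMonic_eq_zero_iff_dvd hφ).1 h
  have hu : ¬ IsUnit φ := fun hu => by
    rw [hφ.eq_one_of_isUnit hu] at hd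
    simp at hd
  exact (eq_of_monic_of_associated hφ hf
    ((hirr.dvd_iff.1 h1).resolve_left hu).symm).symm

end Development

/-! ### The Newton polygon -/

/-- Among finitely many points of the plane, with abscissas on both sides of `j - 1/2`, there are
two that span the edge of the lower convex hull over `j - 1/2`. The edge is the chord that is
lowest at that abscissa, extended to all points that lie on its line. -/
lemma exists_lower_edge (V : Finset ℕ) (u : ℕ → ℚ) (j : ℕ) (h1 : ∃ s ∈ V, s < j)
    (h2 : ∃ t ∈ V, j ≤ t) :
    ∃ s ∈ V, ∃ t ∈ V, s < j ∧ j ≤ t ∧ ∀ l ∈ V,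
      u s + (u t - u s) / ((t : ℚ) - s) * ((l : ℚ) - s) ≤ u l ∧
      (u l = u s + (u t - u s) / ((t : ℚ) - s) * ((l : ℚ) - s) → s ≤ l ∧ l ≤ t) := by
  set m : ℚ := j - 1 / 2 with hm
  set P : Finset (ℕ × ℕ) := (V.filter (· < j)) ×ˢ (V.filter (j ≤ ·)) with hP
  have hPne : P.Nonempty := by
    obtain ⟨s, hs, hsj⟩ := h1
    obtain ⟨t, ht, htj⟩ := h2
    exact ⟨(s, t), by simp [hP, hs, hsj, ht, htj]⟩
  have hlt {s : ℕ} (hs : s < j) : (s : ℚ) < m := by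
    have : (s : ℚ) + 1 ≤ j := by exact_mod_cast hs
    rw [hm]; linarith
  have hgt {t : ℕ} (ht : j ≤ t) : m < (t : ℚ) := by
    have : (j : ℚ) ≤ t := by exact_mod_cast ht
    rw [hm]; linarith
  obtain ⟨⟨s, t⟩, hst, hmin⟩ := P.exists_min_image
    (fun q => ((q.2 - m) * u q.1 + (m - q.1) * u q.2) / ((q.2 : ℚ) - q.1)) hPne
  simp only [hP, Finset.mem_product, Finset.mem_filter] at hst
  obtain ⟨⟨hs, hsj⟩, ht, htj⟩ := hst
  have hs' := hlt hsj
  have ht' := hgt htj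
  set lam : ℚ := (u t - u s) / ((t : ℚ) - s) with hlam
  set L : ℚ → ℚ := fun a => u s + lam * (a - s) with hL
  have hts : (0 : ℚ) < t - s := by linarith
  have hLt : L t = u t := by
    simp only [hL, hlam]; field_simp; ring
  have hLs : L s = u s := by simp [hL]
  have hval {a b : ℕ} (ha : a ∈ V) (haj : a < j) (hb : b ∈ V) (hbj : j ≤ b) :
      L m * ((b : ℚ) - a) ≤ (b - m) * u a + (m - a) * u b := by
    have h := hmin (a, b) (by simp [hP, ha, haj, hb, hbj])
    have hba : (0 : ℚ) < b - a := by linarith [hlt haj, hgt hbj]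
    rw [le_div_iff₀ hba] at h
    refine le_trans (le_of_eq ?_) h
    congr 1
    rw [eq_div_iff hts.ne', ← hLt, ← hLs]
    simp only [hL]; ring
  have hsupp : ∀ l ∈ V, L l ≤ u l := by
    intro l hl
    by_contra hcon
    push Not at hcon
    rcases lt_or_ge l j with hlj | hlj
    · have h := hval hl hlj ht htj
      have h3 : L m * ((t : ℚ) - l) = (t - m) * L l + (m - l) * L t := by
        simp only [hL]; ring
      rw [h3, hLt] at h
      nlinarith [mul_pos (sub_pos.2 ht') (sub_pos.2 hcon)]
    · have h := hval hs hsj hl hlj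
      have h3 : L m * ((l : ℚ) - s) = (l - m) * L s + (m - s) * L l := by
        simp only [hL]; ring
      rw [h3, hLs] at h
      nlinarith [mul_pos (sub_pos.2 hs') (sub_pos.2 hcon)]
  set W : Finset ℕ := V.filter (fun l => u l = L l) with hW
  have hsW : s ∈ W := by simp [hW, hs, hLs]
  have htW : t ∈ W := by simp [hW, ht, hLt]
  have hWne : W.Nonempty := ⟨s, hsW⟩
  have ha := W.min'_mem hWne
  have hb := W.max'_mem hWne
  have has := W.min'_le s hsW
  have htb := W.le_max' t htW
  have hamin : ∀ l ∈ W, W.min' hWne ≤ l := fun l hl => W.min'_le l hl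
  have hbmax : ∀ l ∈ W, l ≤ W.max' hWne := fun l hl => W.le_max' l hl
  generalize W.min' hWne = a at *
  generalize W.max' hWne = b at *
  simp only [hW, Finset.mem_filter] at ha hb
  have hab : (0 : ℚ) < b - a := by
    have : a < b := by omega
    rw [sub_pos]; exact_mod_cast this
  have hslope : (u b - u a) / ((b : ℚ) - a) = lam := by
    rw [ha.2, hb.2, div_eq_iff hab.ne']
    simp only [hL]; ring
  have hline (l : ℕ) : u a + (u b - u a) / ((b : ℚ) - a) * ((l : ℚ) - a) = L l := by
    rw [hslope, ha.2]
    simp only [hL]; ring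
  refine ⟨a, ha.1, b, hb.1, by omega, by omega, fun l hl => ?_⟩
  rw [hline]
  refine ⟨hsupp l hl, fun heq => ?_⟩
  have hlW : l ∈ W := by simp [hW, hl, heq]
  exact ⟨hamin l hlW, hbmax l hlW⟩

section Polygon

variable {p : ℕ} {φ f : ℤ[X]}

lemma mem_cloud {l : ℕ} (h : devVal p φ f l ≠ ⊤) :
    ((l : ℝ), ((devVal p φ f l).toNat : ℝ)) ∈ cloud p φ f :=
  ⟨l, _, (ENat.natCast_toNat h).symm, rfl⟩

lemma forall_mem_cloud {Q : ℝ × ℝ → Prop}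
    (h : ∀ l, devVal p φ f l ≠ ⊤ → Q ((l : ℝ), ((devVal p φ f l).toNat : ℝ))) :
    ∀ P ∈ cloud p φ f, Q P := by
  rintro P ⟨l, u, hu, rfl⟩
  have := h l (by simp [hu])
  rwa [hu, ENat.toNat_natCast] at this

/-- A line below the cloud is below its convex hull. -/
lemma le_of_mem_convexHull_cloud {a b H : ℝ}
    (h : ∀ l : ℕ, devVal p φ f l ≠ ⊤ → H ≤ a * (devVal p φ f l).toNat + b * l) {P : ℝ × ℝ}
    (hP : P ∈ convexHull ℝ (cloud p φ f)) : H ≤ a * P.2 + b * P.1 := by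
  have hconv : Convex ℝ {P : ℝ × ℝ | H ≤ a * P.2 + b * P.1} := by
    intro P hP Q hQ x y hx hy hxy
    simp only [Set.mem_ofPred_eq, Prod.fst_add, Prod.snd_add, Prod.smul_fst, Prod.smul_snd,
      smul_eq_mul] at hP hQ ⊢
    have h1 := mul_le_mul_of_nonneg_left hP hx
    have h2 := mul_le_mul_of_nonneg_left hQ hy
    have h3 : H = x * H + y * H := by rw [← add_mul, hxy, one_mul]
    linarith
  exact convexHull_min (forall_mem_cloud (Q := fun P => P ∈ {P : ℝ × ℝ | H ≤ a * P.2 + b * P.1})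
    fun l hl => h l hl) hconv hP

lemma ordinate_nonneg (p : ℕ) (φ f : ℤ[X]) (x : ℝ) : 0 ≤ ordinate p φ f x := by
  refine Real.sInf_nonneg fun y hy => ?_
  simpa using le_of_mem_convexHull_cloud (a := 1) (b := 0) (H := 0) (fun l _ => by simp) hy

lemma ordinate_le {x y : ℝ} (h : (x, y) ∈ convexHull ℝ (cloud p φ f)) :
    ordinate p φ f x ≤ y := by
  refine csInf_le ⟨0, fun z hz => ?_⟩ h
  simpa using le_of_mem_convexHull_cloud (a := 1) (b := 0) (H := 0) (fun l _ => by simp) hz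

lemma ordinate_le_devVal {l : ℕ} (h : devVal p φ f l ≠ ⊤) :
    ordinate p φ f l ≤ (devVal p φ f l).toNat :=
  ordinate_le (subset_convexHull ℝ _ (mem_cloud h))

lemma mem_convexHull_cloud_chord {l r : ℕ} (hl : devVal p φ f l ≠ ⊤) (hr : devVal p φ f r ≠ ⊤)
    (hlr : l < r) {x : ℝ} (hlx : (l : ℝ) ≤ x) (hxr : x ≤ r) :
    (x, (((r : ℝ) - x) * (devVal p φ f l).toNat + (x - l) * (devVal p φ f r).toNat) / (r - l)) ∈
      convexHull ℝ (cloud p φ f) := by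
  have hpos : (0 : ℝ) < (r : ℝ) - l := by rw [sub_pos]; exact_mod_cast hlr
  have := (convex_convexHull ℝ (cloud p φ f)) (subset_convexHull ℝ _ (mem_cloud hl))
    (subset_convexHull ℝ _ (mem_cloud hr)) (a := ((r : ℝ) - x) / (r - l))
    (b := (x - l) / (r - l)) (div_nonneg (by linarith) hpos.le) (div_nonneg (by linarith) hpos.le)
    (by field_simp; ring)
  convert this using 1
  ext
  · simp; field_simp; ring
  · simp; field_simp

/-- The polygon lies below the chords of the cloud. -/
lemma ordinate_le_chord {l r : ℕ} (hl : devVal p φ f l ≠ ⊤) (hr : devVal p φ f r ≠ ⊤)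
    (hlr : l < r) {x : ℝ} (hlx : (l : ℝ) ≤ x) (hxr : x ≤ r) :
    ((r : ℝ) - l) * ordinate p φ f x ≤
      ((r : ℝ) - x) * (devVal p φ f l).toNat + (x - l) * (devVal p φ f r).toNat := by
  have hpos : (0 : ℝ) < (r : ℝ) - l := by rw [sub_pos]; exact_mod_cast hlr
  have := ordinate_le (mem_convexHull_cloud_chord hl hr hlr hlx hxr)
  rw [le_div_iff₀ hpos] at this
  linarith

/-- A side of negative slope `-h / e`, with `h / e` in lowest terms: the weighted valuation
`e * v + h * x` takes its minimum `H` on the cloud at the points of the side, which are the end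
points of abscissas `s` and `t = s + e * d` and possibly points between them. -/
structure IsWeightedSide (p : ℕ) (φ f : ℤ[X]) (s t e h d H : ℕ) : Prop where
  e_pos : 0 < e
  h_pos : 0 < h
  coprime : Nat.Coprime e h
  d_pos : 0 < d
  eq_add : t = s + e * d
  left_ne_top : devVal p φ f s ≠ ⊤
  right_ne_top : devVal p φ f t ≠ ⊤
  left_eq : e * (devVal p φ f s).toNat + h * s = H
  right_eq : e * (devVal p φ f t).toNat + h * t = H
  le : ∀ l, devVal p φ f l ≠ ⊤ → H ≤ e * (devVal p φ f l).toNat + h * l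
  mem_of_eq : ∀ l, devVal p φ f l ≠ ⊤ → e * (devVal p φ f l).toNat + h * l = H → s ≤ l ∧ l ≤ t

lemma IsSide.isWeightedSide {s t : ℕ} {lam : ℚ} (hside : IsSide p φ f s t lam) (hlam : lam < 0) :
    ∃ h d H, IsWeightedSide p φ f s t lam.den h d H := by
  obtain ⟨hst, us, ut, hus, hut, hl, hsupp⟩ := hside
  have hts : (0 : ℚ) < (t : ℚ) - s := by rw [sub_pos]; exact_mod_cast hst
  have hnum : lam.num < 0 := Rat.num_neg.2 hlam
  obtain ⟨h, hh⟩ : ∃ h : ℕ, lam.num = -(h : ℤ) := ⟨(-lam.num).toNat, by omega⟩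
  have he : 0 < lam.den := lam.den_pos
  have hcop : Nat.Coprime lam.den h := by
    have := lam.reduced
    rw [hh, Int.natAbs_neg, Int.natAbs_natCast] at this
    exact this.symm
  have hlamq : (lam.den : ℚ) * lam = -(h : ℚ) := by
    rw [mul_comm, Rat.mul_den_eq_num, hh]; push_cast; rfl
  have hslope : lam * ((t : ℚ) - s) = ut - us := by rw [hl]; field_simp
  have heq : lam.den * ut + h * t = lam.den * us + h * s := by
    have : (lam.den : ℚ) * ut + h * t = lam.den * us + h * s := by
      linear_combination (-(lam.den : ℚ)) * hslope + ((t : ℚ) - s) * hlamq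
    exact_mod_cast this
  have hdvd : lam.den ∣ t - s := by
    have h1 : lam.den ∣ h * (t - s) := by
      have : h * (t - s) + lam.den * ut = lam.den * us := by
        obtain ⟨r, rfl⟩ := Nat.exists_eq_add_of_lt hst
        have : s + r + 1 - s = r + 1 := by omega
        rw [this]
        nlinarith
      have h2 : lam.den ∣ h * (t - s) + lam.den * ut := this ▸ dvd_mul_right _ _
      exact (Nat.dvd_add_left (dvd_mul_right _ _)).1 h2
    exact hcop.dvd_of_dvd_mul_left h1
  obtain ⟨d, hd⟩ := hdvd
  have hline (l : ℕ) (hl : devVal p φ f l ≠ ⊤) :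
      lam.den * us + h * s ≤ lam.den * (devVal p φ f l).toNat + h * l ∧
      (lam.den * (devVal p φ f l).toNat + h * l = lam.den * us + h * s → s ≤ l ∧ l ≤ t) := by
    obtain ⟨h1, h2⟩ := hsupp l _ (ENat.natCast_toNat hl).symm
    have heq : ((lam.den : ℚ) * (devVal p φ f l).toNat + h * l) - (lam.den * us + h * s) =
        lam.den * ((devVal p φ f l).toNat - (us + lam * ((l : ℚ) - s))) := by
      linear_combination (-(l : ℚ) + s) * (-hlamq)
    have heq0 : (0 : ℚ) < lam.den := by exact_mod_cast he
    constructor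
    · have : ((lam.den : ℚ) * us + h * s) ≤ lam.den * (devVal p φ f l).toNat + h * l := by
        have := mul_nonneg heq0.le (sub_nonneg.2 h1)
        linarith
      exact_mod_cast this
    · intro h3
      apply h2
      have h4 : ((lam.den : ℚ) * (devVal p φ f l).toNat + h * l) = (lam.den * us + h * s) := by
        exact_mod_cast h3
      rw [h4, sub_self, zero_eq_mul] at heq
      exact sub_eq_zero.1 (heq.resolve_left heq0.ne')
  refine ⟨h, d, lam.den * us + h * s, he, by omega, hcop, ?_, by omega, by simp [hus],
    by simp [hut], by simp [hus], by simp [hut, heq], fun l hl => (hline l hl).1,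
    fun l hl => (hline l hl).2⟩
  rcases Nat.eq_zero_or_pos d with rfl | h0
  · omega
  · exact h0

namespace IsWeightedSide

variable {s t e h d H : ℕ}

lemma lt (W : IsWeightedSide p φ f s t e h d H) : s < t := by
  have := Nat.mul_pos W.e_pos W.d_pos
  have := W.eq_add
  omega

/-- Over a side the polygon is the segment of that side. -/
lemma ordinate_eq (W : IsWeightedSide p φ f s t e h d H) {x : ℝ} (hs : (s : ℝ) ≤ x)
    (ht : x ≤ t) : (e : ℝ) * ordinate p φ f x + h * x = H := by
  have he : (0 : ℝ) < e := by exact_mod_cast W.e_pos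
  have hst : (0 : ℝ) < (t : ℝ) - s := by rw [sub_pos]; exact_mod_cast W.lt
  apply le_antisymm
  · have h1 := ordinate_le_chord W.left_ne_top W.right_ne_top W.lt hs ht
    have h2 : (e : ℝ) * (devVal p φ f s).toNat + h * s = H := by exact_mod_cast W.left_eq
    have h3 : (e : ℝ) * (devVal p φ f t).toNat + h * t = H := by exact_mod_cast W.right_eq
    have h4 := mul_le_mul_of_nonneg_left h1 he.le
    refine le_of_mul_le_mul_left ?_ hst
    linear_combination h4 + (t - x) * h2 + (x - s) * h3
  · have hne : {y : ℝ | (x, y) ∈ convexHull ℝ (cloud p φ f)}.Nonempty :=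
      ⟨_, mem_convexHull_cloud_chord W.left_ne_top W.right_ne_top W.lt hs ht⟩
    have : ((H : ℝ) - h * x) / e ≤ ordinate p φ f x := by
      refine le_csInf hne fun y hy => ?_
      have := le_of_mem_convexHull_cloud (a := e) (b := h) (H := H)
        (fun l hl => by exact_mod_cast W.le l hl) hy
      rw [div_le_iff₀ he]
      simp only at this
      linarith
    rw [div_le_iff₀ he] at this
    linarith

end IsWeightedSide

variable [Fact p.Prime]

/-- Between the abscissas `0` and `ord`, the polygon consists of sides of negative slope. -/
lemma exists_isSide (hf : f.Monic) (hφ : φ.Monic) (hirr : Irreducible (reduction p φ))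
    (h0 : devCoeff φ f 0 ≠ 0) {j : ℕ} (hj : 1 ≤ j) (hjo : j ≤ ord p φ f) :
    ∃ s t lam, IsSide p φ f s t lam ∧ lam < 0 ∧ s < j ∧ j ≤ t := by
  classical
  have hd := degree_pos_of_irreducible_reduction hφ hirr
  set V : Finset ℕ := (Finset.range (f.natDegree + 1)).filter (fun l => devVal p φ f l ≠ ⊤)
    with hV
  have hmem (l : ℕ) (hl : devVal p φ f l ≠ ⊤) : l ∈ V := by
    rw [hV, Finset.mem_filter, Finset.mem_range]
    refine ⟨?_, hl⟩
    by_contra hcon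
    exact hl (polyVal_eq_top_iff.2 (devCoeff_eq_zero hd f (by omega)))
  have hV0 : 0 ∈ V := hmem 0 (devVal_ne_top_iff.2 h0)
  have hVo : ord p φ f ∈ V := hmem _ (by rw [devVal_ord hf hφ hirr]; simp)
  obtain ⟨s, hs, t, ht, hsj, hjt, hsupp⟩ := exists_lower_edge V
    (fun l => ((devVal p φ f l).toNat : ℚ)) j ⟨0, hV0, by omega⟩ ⟨_, hVo, hjo⟩
  have hs' : devVal p φ f s ≠ ⊤ := (Finset.mem_filter.1 hs).2
  have ht' : devVal p φ f t ≠ ⊤ := (Finset.mem_filter.1 ht).2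
  refine ⟨s, t, _, ⟨by omega, _, _, (ENat.natCast_toNat hs').symm, (ENat.natCast_toNat ht').symm,
    rfl, fun i u hu => ?_⟩, ?_, hsj, hjt⟩
  · have := hsupp i (hmem i (by simp [hu]))
    rwa [hu, ENat.toNat_natCast] at this
  · by_contra hcon
    push Not at hcon
    -- The point of abscissa `ord` has ordinate `0`, and those before it have positive ordinates.
    have h1 := (hsupp _ hVo).1
    rw [devVal_ord hf hφ hirr] at h1
    have h2 : 1 ≤ (devVal p φ f s).toNat := by
      have := one_le_devVal hf hφ hirr (show s < ord p φ f by omega)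
      rw [← ENat.natCast_toNat hs'] at this
      exact_mod_cast this
    have h3 : (1 : ℚ) ≤ (devVal p φ f s).toNat := by exact_mod_cast h2
    have h4 : (0 : ℚ) ≤ (ord p φ f : ℚ) - s := by
      rw [sub_nonneg]; exact_mod_cast (show s ≤ ord p φ f by omega)
    have h5 := mul_nonneg hcon h4
    simp only [ENat.toNat_zero, Nat.cast_zero] at h1
    linarith

lemma ordinate_ord (hf : f.Monic) (hφ : φ.Monic) (hirr : Irreducible (reduction p φ)) :
    ordinate p φ f (ord p φ f) = 0 := by
  refine le_antisymm ?_ (ordinate_nonneg _ _ _ _)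
  have h := devVal_ord hf hφ hirr
  simpa [h] using ordinate_le_devVal (p := p) (φ := φ) (f := f) (l := ord p φ f) (by simp [h])

/-- The polygon has a supporting line of nonpositive rational slope at each abscissa from `1` to
`ord`. -/
lemma exists_supporting_line (hf : f.Monic) (hfirr : Irreducible f) (hφ : φ.Monic)
    (hirr : Irreducible (reduction p φ)) {j : ℕ} (hj : 1 ≤ j) (hjo : j ≤ ord p φ f) :
    ∃ e h : ℕ, 0 < e ∧ ∀ l, devVal p φ f l ≠ ⊤ →
      e * ⌊ordinate p φ f j⌋₊ + h * j ≤ e * (devVal p φ f l).toNat + h * l := by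
  by_cases h0 : devCoeff φ f 0 = 0
  · have hfφ := eq_of_devCoeff_zero_eq_zero hf hfirr hφ
      (degree_pos_of_irreducible_reduction hφ hirr) h0
    subst hfφ
    have ho : ord p f f = 1 := multiplicity_self (a := reduction p f)
    obtain rfl : j = ord p f f := by omega
    exact ⟨1, 0, one_pos, fun l _ => by simp [ordinate_ord hf hφ hirr]⟩
  · obtain ⟨s, t, lam, hside, hlam, hsj, hjt⟩ := exists_isSide hf hφ hirr h0 hj hjo
    obtain ⟨h, d, H, W⟩ := hside.isWeightedSide hlam
    refine ⟨lam.den, h, W.e_pos, fun l hl => le_trans ?_ (W.le l hl)⟩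
    have h1 := W.ordinate_eq (x := j) (by exact_mod_cast hsj.le) (by exact_mod_cast hjt)
    have h2 := mul_le_mul_of_nonneg_left (Nat.floor_le (ordinate_nonneg p φ f j))
      (Nat.cast_nonneg (α := ℝ) lam.den)
    have : (lam.den : ℝ) * ⌊ordinate p φ f j⌋₊ + h * j ≤ H := by linarith
    exact_mod_cast this

end Polygon

/-! ### Residual polynomials and integral equations -/

section ResidueField

variable {k : Type*} [Field k]

lemma dvd_of_comp_dvd_comp {R P V : k[X]} (hV : V.natDegree ≠ 0) (h : R.comp V ∣ P.comp V) :
    R ∣ P := by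
  rcases eq_or_ne R 0 with rfl | hR
  · rw [zero_comp, zero_dvd_iff] at h
    rw [zero_dvd_iff]
    by_contra hP
    rcases comp_eq_zero_iff.1 h with h1 | ⟨-, h1⟩
    · exact hP h1
    · exact hV (by rw [h1]; simp)
  rw [← EuclideanDomain.mod_eq_zero]
  by_contra hr
  have h1 : R.comp V ∣ (P % R).comp V := by
    rw [EuclideanDomain.mod_eq_sub_mul_div, sub_comp, mul_comp]
    exact dvd_sub h (dvd_mul_right _ _)
  have hr' : (P % R).comp V ≠ 0 := by
    intro h0
    rcases comp_eq_zero_iff.1 h0 with h2 | ⟨-, h2⟩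
    · exact hr h2
    · exact hV (by rw [h2]; simp)
  have h2 := natDegree_le_of_dvd h1 hr'
  rw [natDegree_comp, natDegree_comp] at h2
  have h3 : R.natDegree ≤ (P % R).natDegree := le_of_mul_le_mul_right h2 (Nat.pos_of_ne_zero hV)
  have h4 := degree_mod_lt P hR
  rw [degree_eq_natDegree hr, degree_eq_natDegree hR] at h4
  have : (P % R).natDegree < R.natDegree := by exact_mod_cast h4
  omega

/-- Put `U = c * X`. If `R (U ^ e)` divides a power of `G (U ^ e)`, up to powers of `U` and
constants, then `R` divides `G`: first remove the powers of `U`, which is possible as `R 0 ≠ 0`, then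
replace `U ^ e` by a variable, and use separability last. For `e` divisible by the characteristic,
`R (U ^ e)` itself is not separable. -/
lemma dvd_of_comp_dvd_pow {R G : k[X]} {c v : k} {e s a N : ℕ} (hc : c ≠ 0) (hv : v ≠ 0)
    (he : 0 < e) (hR : R.Separable) (hR0 : R.coeff 0 ≠ 0)
    (h : (C c * X) ^ s * R.comp ((C c * X) ^ e) ∣
      (C v * (C c * X) ^ a * G.comp ((C c * X) ^ e)) ^ N) : R ∣ G := by
  set V : k[X] := (C c * X) ^ e with hV
  have hVd : V.natDegree ≠ 0 := by
    rw [hV, natDegree_pow, natDegree_C_mul_X _ hc]; omega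
  have hX : IsCoprime (R.comp V) (C c * X) := by
    have h1 : IsCoprime (R.comp V) X := by
      refine ((Polynomial.irreducible_X.coprime_iff_not_dvd).2 ?_).symm
      rw [X_dvd_iff, coeff_zero_eq_eval_zero, eval_comp, hV]
      simpa [he.ne', ← coeff_zero_eq_eval_zero] using hR0
    exact (isCoprime_mul_unit_left_right (isUnit_C.2 hc.isUnit) _ _).2 h1
  have h1 : R.comp V ∣ ((C v * (C c * X) ^ a) ^ N) * (G ^ N).comp V := by
    rw [pow_comp, ← mul_pow]
    exact (dvd_mul_left _ _).trans h
  have h2 : IsCoprime (R.comp V) ((C v * (C c * X) ^ a) ^ N) :=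
    ((isCoprime_mul_unit_left_right (isUnit_C.2 hv.isUnit) _ _).2 hX.pow_right).pow_right
  have h3 := dvd_of_comp_dvd_comp hVd (h2.dvd_of_dvd_mul_left h1)
  exact hR.squarefree.isRadical _ _ h3

/-- The polynomial `c (s + e * r) + c (s + e * (r + 1)) * y + ⋯ + c (s + e * d) * y ^ (d - r)`. -/
def tailPoly (c : ℕ → k) (s e d r : ℕ) : k[X] :=
  ∑ i ∈ Finset.range (d + 1 - r), monomial i (c (s + e * (r + i)))

lemma coeff_tailPoly (c : ℕ → k) (s e d r i : ℕ) :
    (tailPoly c s e d r).coeff i = if i < d + 1 - r then c (s + e * (r + i)) else 0 := by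
  simp [tailPoly, coeff_monomial]

/-- A polynomial in `V` with coefficients supported on an arithmetic progression of difference `e`
is a power of `V` times a polynomial in `V ^ e`. -/
lemma sum_eq_pow_mul_tailPoly_comp {c : ℕ → k} {s e d n : ℕ} (he : 0 < e)
    (hc : ∀ l, c l ≠ 0 → ∃ i ≤ d, l = s + e * i) (hn : s + e * d < n) (V : k[X]) {j a r : ℕ}
    (hj : j + a = s + e * r) (ha : a < e ∨ r = 0) :
    ∑ l ∈ Finset.range n, C (c (j + l)) * V ^ l =
      V ^ a * (tailPoly c s e d r).comp (V ^ e) := by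
  rw [tailPoly, Polynomial.sum_comp, Finset.mul_sum]
  symm
  refine Finset.sum_of_injOn (fun i => a + e * i) ?_ ?_ ?_ ?_
  · intro x _ y _ hxy
    simp only at hxy
    exact Nat.eq_of_mul_eq_mul_left he (by omega)
  · intro i hi
    simp only [Finset.coe_range, Set.mem_Iio] at hi ⊢
    have : e * (r + i) ≤ e * d := Nat.mul_le_mul_left e (by omega)
    rw [mul_add] at this
    omega
  · intro l _ hl2
    suffices c (j + l) = 0 by simp [this]
    by_contra hne
    obtain ⟨i, hi, hil⟩ := hc _ hne
    apply hl2
    have hri : r ≤ i := by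
      rcases ha with ha | ha
      · by_contra hcon
        have : e * (i + 1) ≤ e * r := Nat.mul_le_mul_left e (by omega)
        rw [mul_add] at this
        omega
      · omega
    obtain ⟨b, rfl⟩ := Nat.exists_eq_add_of_le hri
    refine ⟨b, by simp; omega, ?_⟩
    simp only
    rw [mul_add] at hil
    omega
  · intro i _
    have : j + (a + e * i) = s + e * (r + i) := by rw [mul_add]; omega
    rw [this, monomial_comp, ← pow_mul, pow_add]
    ring

end ResidueField

section IntegralEquation

lemma eval_scaleRoots_map_C {P : ℤ[X]} (hP : P.Monic) (b x : ℤ[X]) :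
    ((P.map (C : ℤ →+* ℤ[X])).scaleRoots b).eval x = x ^ P.natDegree +
      ∑ i ∈ Finset.range P.natDegree, C (P.coeff i) * b ^ (P.natDegree - i) * x ^ i := by
  have hmon : (P.map (C : ℤ →+* ℤ[X])).Monic := hP.map _
  have hnd : (P.map (C : ℤ →+* ℤ[X])).natDegree = P.natDegree := hP.natDegree_map _
  rw [eval_eq_sum_range, natDegree_scaleRoots, hnd, Finset.sum_range_succ, add_comm]
  congr 1
  · rw [coeff_scaleRoots, hnd, ← hnd, hmon.coeff_natDegree]
    simp
  · refine Finset.sum_congr rfl fun i _ => ?_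
    rw [coeff_scaleRoots, hnd, coeff_map]

lemma eq_minpoly {K : Type*} [Field K] [CharZero K] {f : ℤ[X]} (hf : f.Monic)
    (hirr : Irreducible f) {θ : K} (hθ : aeval θ f = 0) : f = minpoly ℤ θ := by
  have hint : IsIntegral ℤ θ := ⟨f, hf, hθ⟩
  have h1 : minpoly ℤ θ ∣ f := minpoly.isIntegrallyClosed_dvd hint hθ
  exact (eq_of_monic_of_associated (minpoly.monic hint) hf
    ((hirr.dvd_iff.1 h1).resolve_left (minpoly.not_isUnit ℤ θ)).symm).symm

/-- The integral equation of `z`, multiplied by a power of `b`, is a congruence modulo `f` for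
`x = b * z`. -/
lemma dvd_eval_scaleRoots {K : Type*} [Field K] [CharZero K] {f : ℤ[X]} (hf : f.Monic)
    (hirr : Irreducible f) {θ : K} (hθ : aeval θ f = 0) {P : ℤ[X]} (hP : P.Monic) {z : K}
    (hz : aeval z P = 0) {b x : ℤ[X]} (h : aeval θ x = aeval θ b * z) :
    f ∣ ((P.map (C : ℤ →+* ℤ[X])).scaleRoots b).eval x := by
  rw [eq_minpoly hf hirr hθ]
  refine minpoly.isIntegrallyClosed_dvd ⟨f, hf, hθ⟩ ?_
  have h1 : aeval θ (((P.map (C : ℤ →+* ℤ[X])).scaleRoots b).eval x) =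
      aeval θ b ^ P.natDegree * aeval z P := by
    rw [eval_scaleRoots_map_C hP, aeval_eq_sum_range (p := P) z, Finset.sum_range_succ, hP.coeff_natDegree,
      map_add, map_sum, mul_add, Finset.mul_sum, add_comm]
    congr 1
    · refine Finset.sum_congr rfl fun i hi => ?_
      obtain ⟨r, hr⟩ := Nat.exists_eq_add_of_le (Finset.mem_range.1 hi).le
      rw [hr, Nat.add_sub_cancel_left, map_mul, map_mul, map_pow, map_pow, h, aeval_C,
        Algebra.smul_def]
      ring
    · rw [map_pow, h, mul_pow, one_smul]
  rw [h1, hz, mul_zero]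

end IntegralEquation

namespace SlopeModel

variable {p e h : ℕ} {φ : ℤ[X]} (M : SlopeModel p φ e h)

lemma ι_eq_pow_mul (g : ℤ[X]) :
    M.ι g = M.ϖ ^ (e * (polyVal p g).toNat) * M.ι (divPow p (polyVal p g).toNat g) := by
  conv_lhs => rw [eq_pow_mul_divPow p g, map_mul, map_pow, M.ι_prime, ← pow_mul]

lemma ι_prime_pow (n : ℕ) : M.ι (C (p : ℤ) ^ n) = M.ϖ ^ (e * n) := by
  rw [map_pow, M.ι_prime, pow_mul]

lemma ι_phi_pow (n : ℕ) : M.ι (φ ^ n) = M.ϖ ^ (h * n) * M.Θ ^ n := by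
  rw [map_pow, M.ι_phi, mul_pow, pow_mul]

/-- If `z` is a root of the monic polynomial `P` with integer coefficients and `b * z = x` modulo
`f`, where `b` has greater order than `x`, then the equation `P z = 0` multiplied by
`b ^ deg P` shows that the initial form of `f` divides a power of that of `x`. -/
theorem residual_dvd_pow [Fact (Irreducible (reduction p φ))] [Fact p.Prime] {f b x P : ℤ[X]}
    (hP : P.Monic)
    (hdvd : f ∣ ((P.map (C : ℤ →+* ℤ[X])).scaleRoots b).eval x)
    {H D : ℕ} {F₀ X₀ : M.S} (hF : M.ι f = M.ϖ ^ H * F₀) (hF₀ : M.ρ F₀ ≠ 0)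
    (hX : M.ι x = M.ϖ ^ D * X₀) (hb : M.ϖ ^ (D + 1) ∣ M.ι b) :
    M.ρ F₀ ∣ M.ρ X₀ ^ P.natDegree := by
  set N := P.natDegree with hN
  obtain ⟨g, hg⟩ := hdvd
  obtain ⟨β, hβ⟩ := hb
  have hterm : ∀ i ∈ Finset.range N, M.ϖ ^ (N * D + 1) ∣
      M.ι (C (P.coeff i) * b ^ (N - i) * x ^ i) := by
    intro i hi
    rw [Finset.mem_range] at hi
    rw [map_mul, map_mul, map_pow, map_pow, hβ, hX]
    obtain ⟨r, hr⟩ := Nat.exists_eq_add_of_lt hi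
    have h1 : N - i = r + 1 := by omega
    have h2 : N * D + 1 = (i + r + 1) * D + 1 := by rw [hr]
    rw [h1, h2]
    exact ⟨M.ι (C (P.coeff i)) * (β ^ (r + 1) * X₀ ^ i * M.ϖ ^ r), by ring⟩
  obtain ⟨w, hw⟩ := Finset.dvd_sum hterm
  have key : M.ϖ ^ (N * D) * (X₀ ^ N + M.ϖ * w) = M.ϖ ^ H * (F₀ * M.ι g) := by
    have h1 := congrArg M.ι hg
    rw [eval_scaleRoots_map_C hP, map_add, map_sum, hw, map_mul, map_pow, hX, hF] at h1
    linear_combination h1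
  have hρ : M.ρ (X₀ ^ N + M.ϖ * w) = M.ρ X₀ ^ N := by
    rw [map_add, map_mul, M.isReductionMod.map_self, zero_mul, add_zero, map_pow]
  rcases le_total H (N * D) with hle | hle
  · obtain ⟨r, hr⟩ := Nat.exists_eq_add_of_le hle
    rw [hr, pow_add, mul_assoc] at key
    have key2 := M.isReductionMod.pow_regular H key
    obtain ⟨g', hg'⟩ := M.isReductionMod.pow_dvd_of_pow_dvd_mul hF₀ r ⟨_, key2.symm⟩
    rw [hg'] at key2
    have key3 : X₀ ^ N + M.ϖ * w = F₀ * g' := by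
      apply M.isReductionMod.pow_regular r
      rw [key2]; ring
    rw [← hρ, key3, map_mul]
    exact dvd_mul_right _ _
  · obtain ⟨r, hr⟩ := Nat.exists_eq_add_of_le hle
    rw [hr, pow_add, mul_assoc] at key
    have key2 := M.isReductionMod.pow_regular _ key
    rcases Nat.eq_zero_or_pos r with rfl | hr0
    · rw [← hρ, key2]; simp
    · have h0 : M.ρ X₀ ^ N = 0 := by
        rw [← hρ, key2, map_mul, map_pow, M.isReductionMod.map_self, zero_pow hr0.ne', zero_mul]
      rw [h0]
      exact dvd_zero _

end SlopeModel

open scoped Classical in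
/-- The coefficient of the initial form of `f`: the class of `a l / p ^ u l` if the point
`(l, u l)` lies on the line `e * u + h * l = H`, and zero otherwise. -/
def lineCoeff (p : ℕ) (φ f : ℤ[X]) (e h H l : ℕ) : ResidueRing p φ :=
  if devVal p φ f l ≠ ⊤ ∧ e * (devVal p φ f l).toNat + h * l = H then
    AdjoinRoot.mk (reduction p φ)
      (reduction p (divPow p (devVal p φ f l).toNat (devCoeff φ f l)))
  else 0

lemma lineCoeff_ne_zero {p : ℕ} [Fact p.Prime] {φ f : ℤ[X]} {e h H : ℕ} (hφ : φ.Monic) {l : ℕ} (hl : devVal p φ f l ≠ ⊤)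
    (h1 : e * (devVal p φ f l).toNat + h * l = H) : lineCoeff p φ f e h H l ≠ 0 := by
  rw [lineCoeff, if_pos ⟨hl, h1⟩]
  exact mk_divPow_devCoeff_ne_zero hφ (devVal_ne_top_iff.1 hl)

/-- The initial form of the quotient `q j` with respect to a line below the cloud: the terms of its
development have order at least `H - h * j`, with equality for the points on the line. -/
lemma SlopeModel.exists_ι_quot {p e h : ℕ} [Fact p.Prime] {φ f : ℤ[X]} (M : SlopeModel p φ e h)
    (hd : 0 < φ.degree) {H : ℕ}
    (hH : ∀ l, devVal p φ f l ≠ ⊤ → H ≤ e * (devVal p φ f l).toNat + h * l) {j : ℕ}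
    (hj : h * j ≤ H) :
    ∃ w, M.ι (quot φ f j) = M.ϖ ^ (H - h * j) * w ∧
      M.ρ w = ∑ l ∈ Finset.range (f.natDegree + 1),
        C (lineCoeff p φ f e h H (j + l)) * (C M.c * X) ^ l := by
  have hterm (l : ℕ) : ∃ w, M.ι (devCoeff φ f (j + l) * φ ^ l) = M.ϖ ^ (H - h * j) * w ∧
      M.ρ w = C (lineCoeff p φ f e h H (j + l)) * (C M.c * X) ^ l := by
    by_cases h0 : devVal p φ f (j + l) = ⊤
    · refine ⟨0, ?_, ?_⟩
      · rw [polyVal_eq_top_iff.1 h0]; simp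
      · simp [lineCoeff, h0]
    · obtain ⟨r, hr⟩ := Nat.exists_eq_add_of_le (hH _ h0)
      have hexp : e * (devVal p φ f (j + l)).toNat + h * l = (H - h * j) + r := by
        rw [mul_add] at hr; omega
      refine ⟨M.ϖ ^ r * (M.ι (divPow p (devVal p φ f (j + l)).toNat (devCoeff φ f (j + l))) *
        M.Θ ^ l), ?_, ?_⟩
      · rw [map_mul, M.ι_eq_pow_mul (devCoeff φ f (j + l)), M.ι_phi_pow, ← mul_assoc (M.ϖ ^ _),
          ← pow_add, ← hexp, pow_add, ← devVal]
        ring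
      · rw [map_mul, map_mul, map_pow, map_pow, M.isReductionMod.map_self, M.ρ_ι, M.ρ_Theta,
          lineCoeff]
        rcases Nat.eq_zero_or_pos r with rfl | hr0
        · rw [if_pos ⟨h0, by omega⟩, pow_zero, one_mul]
        · rw [if_neg (by rintro ⟨-, h2⟩; omega), zero_pow hr0.ne']
          simp
  choose w hw1 hw2 using hterm
  refine ⟨∑ l ∈ Finset.range (f.natDegree + 1), w l, ?_, ?_⟩
  · rw [quot_eq_sum hd f j, map_sum, Finset.mul_sum]
    exact Finset.sum_congr rfl fun l _ => hw1 l
  · rw [map_sum]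
    exact Finset.sum_congr rfl fun l _ => hw2 l

namespace IsWeightedSide

variable {p : ℕ} {φ f : ℤ[X]} {s t e h d H : ℕ}

lemma exists_of_lineCoeff_ne_zero (W : IsWeightedSide p φ f s t e h d H) (l : ℕ)
    (hl : lineCoeff p φ f e h H l ≠ 0) : ∃ i ≤ d, l = s + e * i := by
  rw [lineCoeff] at hl
  split_ifs at hl with hc
  · obtain ⟨hs, ht⟩ := W.mem_of_eq l hc.1 hc.2
    obtain ⟨r, rfl⟩ := Nat.exists_eq_add_of_le hs
    have h1 : e ∣ h * r := by
      have h2 := W.left_eq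
      have h3 : e * (devVal p φ f (s + r)).toNat + h * r = e * (devVal p φ f s).toNat := by
        have := hc.2
        rw [mul_add] at this
        omega
      have h4 : e ∣ e * (devVal p φ f (s + r)).toNat + h * r := h3 ▸ dvd_mul_right _ _
      exact (Nat.dvd_add_right (dvd_mul_right _ _)).1 h4
    obtain ⟨i, rfl⟩ := W.coprime.dvd_of_dvd_mul_left h1
    refine ⟨i, ?_, rfl⟩
    have := W.eq_add
    exact Nat.le_of_mul_le_mul_left (by omega : e * i ≤ e * d) W.e_pos
  · exact absurd rfl hl

lemma lineCoeff_eq_residualCoeff (W : IsWeightedSide p φ f s t e h d H) {l : ℕ} (hs : s ≤ l)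
    (ht : l ≤ t) : lineCoeff p φ f e h H l = residualCoeff p φ f l := by
  classical
  have h1 := W.ordinate_eq (x := l) (by exact_mod_cast hs) (by exact_mod_cast ht)
  have he : (e : ℝ) ≠ 0 := by exact_mod_cast W.e_pos.ne'
  rw [lineCoeff, residualCoeff]
  refine if_congr (and_congr_right fun _ => ?_) rfl rfl
  rw [← @Nat.cast_inj ℝ]
  push_cast
  constructor
  · intro h2
    exact mul_left_cancel₀ he (by linarith)
  · intro h2
    rw [h2, h1]

end IsWeightedSide

/-! ### Orders of the quotients -/

namespace IsWeightedSide

variable {p : ℕ} {φ f : ℤ[X]} {s t e h d H : ℕ}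

/-- Terms of the development of `f` before `j`, for `j` not after the left end of the side. -/
lemma lt_of_le_left (W : IsWeightedSide p φ f s t e h d H) {l j : ℕ} (hlj : l < j) (hjs : j ≤ s)
    (hl : devVal p φ f l ≠ ⊤) :
    (e : ℝ) * ordinate p φ f j + h * j < e * (devVal p φ f l).toNat + h * l := by
  have h1 := ordinate_le_chord hl W.left_ne_top (by omega) (x := j) (by exact_mod_cast hlj.le)
    (by exact_mod_cast hjs)
  have h2 : H < e * (devVal p φ f l).toNat + h * l :=
    lt_of_le_of_ne (W.le l hl) fun heq => by
      have := (W.mem_of_eq l hl heq.symm).1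
      omega
  have h3 : (H : ℝ) < e * (devVal p φ f l).toNat + h * l := by exact_mod_cast h2
  have h4 : (e : ℝ) * (devVal p φ f s).toNat + h * s = H := by exact_mod_cast W.left_eq
  have h5 : (0 : ℝ) < (j : ℝ) - l := by rw [sub_pos]; exact_mod_cast hlj
  have h6 : (j : ℝ) ≤ s := by exact_mod_cast hjs
  have he : (0 : ℝ) ≤ e := Nat.cast_nonneg e
  refine lt_of_mul_lt_mul_left ?_ (show (0 : ℝ) ≤ (s : ℝ) - l by linarith)
  have h7 := mul_le_mul_of_nonneg_left h1 he
  have h8 := mul_pos h5 (sub_pos.2 h3)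
  linear_combination h7 + h8 + (j - l) * h4

/-- Terms of the development of `q j`, for `j` after the left end of the side. -/
lemma le_of_left_lt (W : IsWeightedSide p φ f s t e h d H) {l j : ℕ} (hjl : j ≤ l) (hsj : s < j)
    (hl : devVal p φ f l ≠ ⊤) :
    (e : ℝ) * ordinate p φ f j + h * j ≤ e * (devVal p φ f l).toNat + h * l := by
  have he : (0 : ℝ) ≤ e := Nat.cast_nonneg e
  have hH : (H : ℝ) ≤ e * (devVal p φ f l).toNat + h * l := by exact_mod_cast W.le l hl
  rcases le_or_gt j t with hjt | hjt
  · rwa [W.ordinate_eq (by exact_mod_cast hsj.le) (by exact_mod_cast hjt)]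
  rcases hjl.eq_or_lt with rfl | hjl
  · have := mul_le_mul_of_nonneg_left (ordinate_le_devVal hl) he
    linarith
  have h1 := ordinate_le_chord W.right_ne_top hl (by omega) (x := j) (by exact_mod_cast hjt.le)
    (by exact_mod_cast hjl.le)
  have h4 : (e : ℝ) * (devVal p φ f t).toNat + h * t = H := by exact_mod_cast W.right_eq
  have h5 : (0 : ℝ) < (l : ℝ) - j := by rw [sub_pos]; exact_mod_cast hjl
  have h6 : (t : ℝ) < j := by exact_mod_cast hjt
  refine le_of_mul_le_mul_left ?_ (show (0 : ℝ) < (l : ℝ) - t by linarith)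
  have h7 := mul_le_mul_of_nonneg_left h1 he
  have h8 := mul_nonneg h5.le (sub_nonneg.2 hH)
  linear_combination h7 + h8 + (l - j) * h4

end IsWeightedSide

section Order

variable {p : ℕ} [Fact p.Prime] {φ f : ℤ[X]}

/-- Before the abscissa `ord` the points of the cloud lie at least one unit above the integral
part of each later ordinate. -/
lemma floor_ordinate_lt_devVal (hf : f.Monic) (hφ : φ.Monic) (hirr : Irreducible (reduction p φ))
    {l j : ℕ} (hlj : l < j) (hj : j ≤ ord p φ f) (hl : devVal p φ f l ≠ ⊤) :
    ⌊ordinate p φ f j⌋₊ < (devVal p φ f l).toNat := by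
  rw [Nat.floor_lt (ordinate_nonneg _ _ _ _)]
  have ho := devVal_ord hf hφ hirr
  have h1 := ordinate_le_chord hl (show devVal p φ f (ord p φ f) ≠ ⊤ by simp [ho])
    (by omega) (x := j) (by exact_mod_cast hlj.le) (by exact_mod_cast hj)
  rw [ho] at h1
  have h2 : 1 ≤ (devVal p φ f l).toNat := by
    have := one_le_devVal hf hφ hirr (show l < ord p φ f by omega)
    rw [← ENat.natCast_toNat hl] at this
    exact_mod_cast this
  have h3 : (1 : ℝ) ≤ (devVal p φ f l).toNat := by exact_mod_cast h2
  have h4 : (l : ℝ) < j := by exact_mod_cast hlj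
  have h5 : (j : ℝ) ≤ ord p φ f := by exact_mod_cast hj
  have h6 : (0 : ℝ) < (ord p φ f : ℝ) - l := by linarith
  refine lt_of_mul_lt_mul_left ?_ h6.le
  refine h1.trans_lt ?_
  simp only [ENat.toNat_zero, Nat.cast_zero, mul_zero, add_zero]
  exact mul_lt_mul_of_pos_right (by linarith) (by linarith)

/-- Modulo `f`, the product `φ' ^ j * q j` is minus the beginning of the development of `f`. -/
lemma aeval_pow_mul_quot {K : Type*} [Field K] {θ : K} (hθ : aeval θ f = 0) (φ : ℤ[X]) (j : ℕ) :
    aeval θ φ ^ j * aeval θ (quot φ f j) =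
      aeval θ (-∑ l ∈ Finset.range j, devCoeff φ f l * φ ^ l) := by
  have h := congrArg (aeval θ) (eq_sum_add_pow_mul_quot φ f 0 j)
  simp only [zero_add] at h
  rw [show quot φ f 0 = f by rw [quot], hθ, map_add, map_mul, map_pow] at h
  rw [map_neg]
  linear_combination -h

variable {e h : ℕ}

lemma SlopeModel.pow_dvd_ι_mul (M : SlopeModel p φ e h) {φ' : ℤ[X]} {l x : ℕ} {g : ℤ[X]}
    (hx : devVal p φ' f l ≠ ⊤ → M.ϖ ^ x ∣ M.ϖ ^ (e * (devVal p φ' f l).toNat) * M.ι g) :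
    M.ϖ ^ x ∣ M.ι (devCoeff φ' f l * g) := by
  by_cases h0 : devVal p φ' f l = ⊤
  · rw [polyVal_eq_top_iff.1 h0]; simp
  · rw [map_mul, M.ι_eq_pow_mul, ← devVal, mul_right_comm]
    exact (hx h0).mul_right _

/-- A representative modulo `f` of `B * q j`, when `B` is a multiple of `φ' ^ j`, obtained from
the beginning of the development. -/
lemma SlopeModel.exists_lower_representative (M : SlopeModel p φ e h) {K : Type*} [Field K]
    {θ : K} (hθ : aeval θ f = 0) {φ' g : ℤ[X]} {j x : ℕ}
    (hx : ∀ l < j, devVal p φ' f l ≠ ⊤ →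
      M.ϖ ^ x ∣ M.ϖ ^ (e * (devVal p φ' f l).toNat) * M.ι (φ' ^ l * g)) :
    ∃ Q, aeval θ Q = aeval θ (φ' ^ j * g) * aeval θ (quot φ' f j) ∧ M.ϖ ^ x ∣ M.ι Q := by
  refine ⟨(-∑ l ∈ Finset.range j, devCoeff φ' f l * φ' ^ l) * g, ?_, ?_⟩
  · rw [map_mul, ← aeval_pow_mul_quot hθ, map_mul, map_pow]
    ring
  · rw [neg_mul, map_neg, dvd_neg, Finset.sum_mul, map_sum]
    refine Finset.dvd_sum fun l hl => ?_
    rw [mul_assoc]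
    exact M.pow_dvd_ι_mul (hx l (Finset.mem_range.1 hl))

/-- A representative modulo `f` of `φ ^ n * g * q j`, for the polynomial `φ` of the model, of the
order read off from the development on one side of `j`: the beginning if `j ≤ s`, and the end
otherwise. -/
lemma SlopeModel.exists_representative (M : SlopeModel p φ e h) (hd : 0 < φ.degree)
    {K : Type*} [Field K] {θ : K} (hθ : aeval θ f = 0) {g : ℤ[X]} {j n m s : ℕ} (hjn : j ≤ n)
    (hm : ∀ l, devVal p φ f l ≠ ⊤ → (j ≤ s ∧ l < j) ∨ (s < j ∧ j ≤ l) →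
      m + h * j ≤ e * (devVal p φ f l).toNat + h * l) :
    ∃ Q, aeval θ Q = aeval θ (φ ^ n * g) * aeval θ (quot φ f j) ∧
      M.ϖ ^ (m + h * n) ∣ M.ι Q := by
  rcases le_or_gt j s with hjs | hjs
  · obtain ⟨r, rfl⟩ := Nat.exists_eq_add_of_le hjn
    have hx : ∀ l < j, devVal p φ f l ≠ ⊤ → M.ϖ ^ (m + h * (j + r)) ∣
        M.ϖ ^ (e * (devVal p φ f l).toNat) * M.ι (φ ^ l * (φ ^ r * g)) := by
      intro l hlj hl
      rw [← mul_assoc, ← pow_add, map_mul, M.ι_phi_pow, mul_assoc, ← mul_assoc (M.ϖ ^ _),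
        ← pow_add]
      refine (pow_dvd_pow _ ?_).mul_right _
      have := hm l hl (.inl ⟨hjs, hlj⟩)
      simp only [mul_add]
      omega
    obtain ⟨Q, hQ, hdvd⟩ := M.exists_lower_representative hθ hx
    exact ⟨Q, by rw [hQ, ← mul_assoc, ← pow_add], hdvd⟩
  · refine ⟨φ ^ n * g * quot φ f j, by rw [map_mul], ?_⟩
    rw [mul_assoc, map_mul, M.ι_phi_pow, map_mul, mul_assoc, add_comm, pow_add]
    refine mul_dvd_mul_left _ (Dvd.dvd.mul_left (Dvd.dvd.mul_left ?_ _) _)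
    rw [quot_eq_sum hd f j, map_sum]
    refine Finset.dvd_sum fun l _ => M.pow_dvd_ι_mul fun hl => ?_
    rw [M.ι_phi_pow, ← mul_assoc, ← pow_add]
    refine (pow_dvd_pow _ ?_).mul_right _
    have := hm _ hl (.inr ⟨hjs, by omega⟩)
    rw [mul_add] at this
    omega

end Order

/-! ### Integral combinations divisible by a prime -/

section Independence

variable {p : ℕ} {f : ℤ[X]} {t : ℕ} {φ : Fin t → ℤ[X]}

namespace IsFactorLift

lemma irreducible (hφ : IsFactorLift p f φ) (i : Fin t) : Irreducible (reduction p (φ i)) := by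
  have : reduction p (φ i) ∈ Set.range (fun i => reduction p (φ i)) := ⟨i, rfl⟩
  rw [hφ.range_eq] at this
  exact this.2.1

lemma dvd (hφ : IsFactorLift p f φ) (i : Fin t) : reduction p (φ i) ∣ reduction p f := by
  have : reduction p (φ i) ∈ Set.range (fun i => reduction p (φ i)) := ⟨i, rfl⟩
  rw [hφ.range_eq] at this
  exact this.2.2

lemma eq_of_dvd [Fact p.Prime] (hφ : IsFactorLift p f φ) {i i' : Fin t}
    (h : reduction p (φ i) ∣ reduction p (φ i')) : i = i' := by
  apply hφ.injective
  exact eq_of_monic_of_associated ((hφ.monic i).map _) ((hφ.monic i').map _)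
    ((hφ.irreducible i).associated_of_dvd (hφ.irreducible i') h)

end IsFactorLift

variable [Fact p.Prime] {K : Type*} [Field K] [CharZero K] {θ z : K}

/-- The case `f = φ`, in which the family consists of the powers of `θ`. -/
lemma reduction_eq_zero_of_irreducible_reduction (hf : f.Monic) (hfirr : Irreducible f)
    (hirr : Irreducible (reduction p f)) (hθ : aeval θ f = 0) (hz : IsIntegral ℤ z) {A : ℤ[X]}
    (hA : A.degree < f.degree) (h : aeval θ A = p * z) : reduction p A = 0 := by
  set P := minpoly ℤ z with hPdef
  have hP : P.Monic := minpoly.monic hz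
  have hdvd := dvd_eval_scaleRoots hf hfirr hθ hP (minpoly.aeval ℤ z) (b := C (p : ℤ)) (x := A)
    (by simpa using h)
  rw [eval_scaleRoots_map_C hP] at hdvd
  have h1 := Polynomial.map_dvd (Int.castRingHom (ZMod p)) hdvd
  rw [Polynomial.map_add, Polynomial.map_sum, Finset.sum_eq_zero, add_zero,
    Polynomial.map_pow] at h1
  · have h2 := hirr.prime.dvd_of_dvd_pow h1
    by_contra hne
    exact mk_reduction_ne_zero hf hA hne (AdjoinRoot.mk_eq_zero.2 h2)
  · intro i hi
    have : P.natDegree - i ≠ 0 := by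
      have := Finset.mem_range.1 hi
      omega
    simp [this]

/-- A combination of proper tails of a polynomial of degree `d` is nonzero, of degree less than
`d`. -/
lemma not_tailPoly_dvd_sum {k : Type*} [Field k] {c : ℕ → k} {s e d : ℕ}
    (hc : c (s + e * d) ≠ 0) {T : Finset ℕ} (hT : T.Nonempty) {a : ℕ → k}
    (ha : ∀ j ∈ T, a j ≠ 0) {r : ℕ → ℕ} (hr : ∀ j ∈ T, 1 ≤ r j ∧ r j ≤ d)
    (hinj : Set.InjOn r T) :
    ¬ tailPoly c s e d 0 ∣ ∑ j ∈ T, C (a j) * tailPoly c s e d (r j) := by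
  intro hdvd
  set G := ∑ j ∈ T, C (a j) * tailPoly c s e d (r j) with hG
  have hcoeff (i : ℕ) : G.coeff i =
      ∑ j ∈ T, a j * if i < d + 1 - r j then c (s + e * (r j + i)) else 0 := by
    rw [hG, finsetSum_coeff]
    simp only [coeff_C_mul, coeff_tailPoly]
  have hG0 : G ≠ 0 := by
    obtain ⟨j, hj, hmin⟩ := T.exists_min_image r hT
    intro h0
    have h1 := hcoeff (d - r j)
    rw [h0, coeff_zero, Finset.sum_eq_single_of_mem j hj] at h1
    · have h2 := hr j hj
      rw [if_pos (by omega), show r j + (d - r j) = d by omega] at h1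
      exact mul_ne_zero (ha j hj) hc h1.symm
    · intro j' hj' hne
      have h2 := hmin j' hj'
      have h3 : r j' ≠ r j := fun h => hne (hinj hj' hj h)
      rw [if_neg (by omega), mul_zero]
  have h1 := natDegree_le_of_dvd hdvd hG0
  have h2 : d ≤ (tailPoly c s e d 0).natDegree := by
    refine le_natDegree_of_ne_zero ?_
    rw [coeff_tailPoly, if_pos (by omega), zero_add]
    exact hc
  refine leadingCoeff_ne_zero.2 hG0 ?_
  rw [leadingCoeff, hcoeff]
  refine Finset.sum_eq_zero fun j hj => ?_
  have := hr j hj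
  rw [if_neg (by omega), mul_zero]

/-- Abscissas `j` after the left end `s` of a side, all congruent modulo `e`, have the same
distance `a < e` to the next abscissa `s + e * r` of a lattice point of the side. -/
lemma exists_next_abscissa {s e d j₀ : ℕ} (he : 0 < e) (hsj : s < j₀) (hjt : j₀ ≤ s + e * d) :
    ∃ a < e, ∀ j, s < j → j ≤ j₀ → e ∣ j₀ - j → ∃ r, 1 ≤ r ∧ r ≤ d ∧ j + a = s + e * r := by
  obtain ⟨b, hb⟩ := Nat.exists_eq_add_of_lt hsj
  have h1 := Nat.div_add_mod b e
  have h2 := Nat.mod_lt b he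
  refine ⟨e - 1 - b % e, by omega, fun j hj hj0 hdvd => ?_⟩
  obtain ⟨g, hg⟩ := hdvd
  have hr : e * (b / e + 1) = e * (b / e) + e := by ring
  have hlt : e * g < e * (b / e + 1) := by omega
  have hlt' := lt_of_mul_lt_mul_left hlt (Nat.zero_le e)
  obtain ⟨r, hr'⟩ := Nat.exists_eq_add_of_lt hlt'
  have hsum : e * (b / e + 1) = e * g + e * (r + 1) := by rw [hr']; ring
  refine ⟨r + 1, by omega, ?_, by omega⟩
  have : e * (r + 1) < e * (d + 1) := by
    rw [mul_add e d 1]; omega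
  have := lt_of_mul_lt_mul_left this (Nat.zero_le e)
  omega

/-- The coefficients of a combination of the family that lies in `p * Z_K` are divisible by `p`.
The degree of `A i j` is less than that of `φ i`, so these polynomials collect the coefficients of
`θ ^ k`, `k < deg φ i`. -/
theorem reduction_eq_zero_of_isIntegral (hf : f.Monic) (hfirr : Irreducible f)
    (hφ : IsFactorLift p f φ) (hreg : IsRegular p f φ) (hθ : aeval θ f = 0) (hz : IsIntegral ℤ z)
    {A : Fin t → ℕ → ℤ[X]} (hA : ∀ i j, (A i j).degree < (φ i).degree)
    (h : ∑ i, ∑ j ∈ Finset.Icc 1 (ord p (φ i) f), aeval θ (A i j) * aeval θ (quot (φ i) f j) /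
      (p : K) ^ ⌊ordinate p (φ i) f j⌋₊ = p * z) (i : Fin t) {j : ℕ}
    (hj : j ∈ Finset.Icc 1 (ord p (φ i) f)) : reduction p (A i j) = 0 := by
  classical
  by_contra hne
  have hirr := hφ.irreducible i
  have hφi := hφ.monic i
  have hd := degree_pos_of_irreducible_reduction hφi hirr
  by_cases h0 : devCoeff (φ i) f 0 = 0
  · -- Here `f = φ i`, and there are no other factors.
    have hfφ := eq_of_devCoeff_zero_eq_zero hf hfirr hφi hd h0
    have huniv : (Finset.univ : Finset (Fin t)) = {i} := by
      ext i'
      simpa using hφ.eq_of_dvd (hfφ ▸ hφ.dvd i')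
    have ho : ord p (φ i) f = 1 := by
      rw [ord, hfφ]
      exact multiplicity_self
    have hy := ordinate_ord (p := p) hf hφi hirr
    rw [ho] at hj hy
    obtain rfl : j = 1 := by simpa using hj
    have hq : quot (φ i) f 1 = 1 := by
      have h1 := quot_eq_devCoeff_add (φ i) f 0
      rw [h0, zero_add, zero_add, show quot (φ i) f 0 = f by rw [quot]] at h1
      refine mul_left_cancel₀ hφi.ne_zero ?_
      rw [← h1, mul_one, hfφ]
    rw [huniv, Finset.sum_singleton, ho, Finset.Icc_self, Finset.sum_singleton, hq, hy] at h
    refine hne (reduction_eq_zero_of_irreducible_reduction hf hfirr (hfφ ▸ hirr) hθ hz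
      (hfφ ▸ hA i 1) ?_)
    simpa using h
  have hp0 : (p : K) ≠ 0 := by exact_mod_cast (Fact.out : p.Prime).ne_zero
  set ℓ := ord p (φ i) f with hℓ
  set y : ℕ → ℝ := fun j => ordinate p (φ i) f j with hy
  set n : ℕ → ℕ := fun j => ⌊y j⌋₊ with hn
  have hny (j : ℕ) : (n j : ℝ) ≤ y j := Nat.floor_le (ordinate_nonneg _ _ _ _)
  have hyn (j : ℕ) : y j < n j + 1 := Nat.lt_floor_add_one _
  -- Among the coefficients that are nonzero modulo `p`, choose those with the least fractional
  -- part of the ordinate, and let `j₀` be the largest abscissa among them.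
  set T₁ := (Finset.Icc 1 ℓ).filter fun j => reduction p (A i j) ≠ 0 with hT₁
  obtain ⟨j₁, hj₁, hmin⟩ := T₁.exists_min_image (fun j => y j - n j) ⟨j, by simp [hT₁, hj, hne]⟩
  obtain ⟨j₀, hj₀, hmax⟩ := (T₁.filter fun j => y j - n j = y j₁ - n j₁).exists_max_image id
    ⟨j₁, by simp [hj₁]⟩
  rw [Finset.mem_filter] at hj₀
  obtain ⟨hj₀T, hj₀δ⟩ := hj₀
  rw [← hj₀δ] at hmin hmax
  have hj₀I : j₀ ∈ Finset.Icc 1 ℓ := (Finset.mem_filter.1 hj₀T).1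
  rw [Finset.mem_Icc] at hj₀I
  obtain ⟨s, τ, lam, hside, hlam, hsj, hjτ⟩ := exists_isSide hf hφi hirr h0 hj₀I.1 hj₀I.2
  obtain ⟨η, d, H, W⟩ := hside.isWeightedSide hlam
  have hsep := hreg i s τ lam hside hlam
  set e := lam.den with he
  have hepos := W.e_pos
  have heR : (0 : ℝ) < e := by exact_mod_cast hepos
  have : Fact (Irreducible (reduction p (φ i))) := ⟨hirr⟩
  -- The model in which `p` has order `e` and `φ i` has order `η`.
  obtain ⟨M⟩ := SlopeModel.exists hφi hirr hepos W.h_pos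
  have hyside {j : ℕ} (h1 : s ≤ j) (h2 : j ≤ τ) : (e : ℝ) * y j + η * j = H :=
    W.ordinate_eq (by exact_mod_cast h1) (by exact_mod_cast h2)
  -- The natural number `x = e * (y j₀ - n j₀)` is the least fractional part, in the scale of `ϖ`.
  obtain ⟨x, hx⟩ : ∃ x, H = (e * n j₀ + η * j₀) + x := by
    refine Nat.exists_eq_add_of_le ?_
    have h1 := hyside hsj.le hjτ
    have h2 := mul_le_mul_of_nonneg_left (hny j₀) heR.le
    have : (e : ℝ) * n j₀ + η * j₀ ≤ H := by linarith
    exact_mod_cast this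
  have hxR : (x : ℝ) = e * (y j₀ - n j₀) := by
    have h1 := hyside hsj.le hjτ
    have h2 : (H : ℝ) = (e * n j₀ + η * j₀) + x := by exact_mod_cast hx
    linarith
  have hxe : x < e := by
    have : (x : ℝ) < e := by
      rw [hxR]
      have := mul_lt_mul_of_pos_left (hyn j₀) heR
      linarith
    exact_mod_cast this
  clear hj hne j
  -- The factor `B` makes room for the powers of `φ i'` that the replacement of `q j` by the
  -- beginning of the development uses; in the model its part `Bi` prime to `φ i` is a unit.
  set Bi : ℤ[X] := ∏ i' ∈ Finset.univ.erase i, φ i' ^ ord p (φ i') f with hBi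
  set B : ℤ[X] := φ i ^ ℓ * Bi with hB
  set v := AdjoinRoot.mk (reduction p (φ i)) (reduction p Bi) with hv
  have hv0 : v ≠ 0 := by
    have hBr : reduction p Bi =
        ∏ i' ∈ Finset.univ.erase i, reduction p (φ i') ^ ord p (φ i') f := by
      simp only [hBi, Polynomial.map_prod, Polynomial.map_pow]
    rw [hv, hBr, map_prod, Finset.prod_ne_zero_iff]
    intro i' hi'
    rw [map_pow]
    refine pow_ne_zero _ fun h1 => ?_
    exact Finset.ne_of_mem_erase hi' (hφ.eq_of_dvd (AdjoinRoot.mk_eq_zero.1 h1)).symm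
  obtain ⟨Y, hY⟩ : ∃ Y, ∀ i', ∀ j ∈ Finset.Icc 1 (ord p (φ i') f),
      ⌊ordinate p (φ i') f j⌋₊ ≤ Y := by
    refine ⟨∑ i', ∑ j ∈ Finset.Icc 1 (ord p (φ i') f), ⌊ordinate p (φ i') f j⌋₊,
      fun i' j hj => ?_⟩
    exact (Finset.single_le_sum (f := fun j : ℕ => ⌊ordinate p (φ i') f j⌋₊)
      (fun _ _ => Nat.zero_le _) hj).trans
      (Finset.single_le_sum
        (f := fun i' => ∑ j ∈ Finset.Icc 1 (ord p (φ i') f), ⌊ordinate p (φ i') f j⌋₊)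
        (fun _ _ => Nat.zero_le _) (Finset.mem_univ i'))
  -- The abscissas of the terms that contribute to the initial form.
  set T₂ := T₁.filter fun j => y j - n j = y j₀ - n j₀ ∧ s < j with hT₂
  have hT₂mem {j : ℕ} (hj : j ∈ T₂) : j ∈ T₁ ∧ y j - n j = y j₀ - n j₀ ∧ s < j :=
    Finset.mem_filter.1 hj
  have hT₂le {j : ℕ} (hj : j ∈ T₂) : j ≤ j₀ := by
    obtain ⟨h1, h2, -⟩ := hT₂mem hj
    exact hmax j (Finset.mem_filter.2 ⟨h1, by rw [h2, hj₀δ]⟩)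
  have hT₂eq {j : ℕ} (hj : j ∈ T₂) : e * n j + η * j + x = H := by
    have h1 := hyside (hT₂mem hj).2.2.le ((hT₂le hj).trans hjτ)
    have h2 := (hT₂mem hj).2.1
    have : (e : ℝ) * n j + η * j + x = H := by
      rw [hxR, ← h2, ← h1]; ring
    exact_mod_cast this
  obtain ⟨a, hae, hnext⟩ := exists_next_abscissa hepos hsj (W.eq_add ▸ hjτ)
  have hr : ∀ j ∈ T₂, ∃ r, 1 ≤ r ∧ r ≤ d ∧ j + a = s + e * r := by
    intro j hj
    refine hnext j (hT₂mem hj).2.2 (hT₂le hj) ?_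
    obtain ⟨g, hg⟩ := Nat.exists_eq_add_of_le (hT₂le hj)
    have h1 := hT₂eq hj
    rw [hx, hg, mul_add] at h1
    have h2 : e ∣ e * n j₀ + η * g := ⟨n j, by rw [hg]; omega⟩
    have h3 := W.coprime.dvd_of_dvd_mul_left ((Nat.dvd_add_right (dvd_mul_right _ _)).1 h2)
    rwa [hg, Nat.add_sub_cancel_left]
  choose! r hr1 hr2 hr3 using hr
  set c := lineCoeff p (φ i) f e η H with hc
  set V : (ResidueRing p (φ i))[X] := C M.c * X with hV
  have hzero {N : ℕ} {g : ℤ[X]} (hg : M.ϖ ^ (N + 1) ∣ M.ι g) :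
      ∃ w, M.ι g = M.ϖ ^ N * w ∧ M.ρ w = 0 := by
    obtain ⟨u, hu⟩ := hg
    exact ⟨M.ϖ * u, by rw [hu]; ring, by rw [map_mul, M.isReductionMod.map_self, zero_mul]⟩
  have hsum (b a r : ℕ) (h1 : b + a = s + e * r) (h2 : a < e ∨ r = 0) :
      ∑ l ∈ Finset.range (f.natDegree + 1), C (c (b + l)) * V ^ l =
        V ^ a * (tailPoly c s e d r).comp (V ^ e) := by
    refine sum_eq_pow_mul_tailPoly_comp hepos (W.exists_of_lineCoeff_ne_zero) ?_ V h1 h2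
    rw [← W.eq_add]
    by_contra hcon
    exact W.right_ne_top (polyVal_eq_top_iff.2 (devCoeff_eq_zero hd f (by omega)))
  -- Representatives of the summands `A * q j`, up to `B` and a power of `p`.
  have key' : ∀ i', ∀ j ∈ Finset.Icc 1 (ord p (φ i') f), ∃ Q w,
      aeval θ Q = aeval θ B * aeval θ (quot (φ i') f j) ∧
      M.ι (A i' j * Q) = M.ϖ ^ (x + e * ⌊ordinate p (φ i') f j⌋₊ + η * ℓ) * w ∧
      M.ρ w = if i' = i ∧ j ∈ T₂ then
        C (AdjoinRoot.mk (reduction p (φ i)) (reduction p (A i j))) *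
          (C v * V ^ (ℓ + a) * (tailPoly c s e d (r j)).comp (V ^ e)) else 0 := by
    intro i' j hj
    rw [Finset.mem_Icc] at hj
    rcases eq_or_ne i' i with rfl | hii
    · by_cases hjT : j ∈ T₂
      · -- The initial form is read off from the end of the development.
        have h1 := hT₂eq hjT
        obtain ⟨w, hw1, hw2⟩ := M.exists_ι_quot hd W.le (show η * j ≤ H by omega)
        refine ⟨B * quot (φ i') f j, M.ι (A i' j) * (M.Θ ^ ℓ * M.ι Bi * w), by rw [map_mul], ?_, ?_⟩
        · rw [map_mul, map_mul, hB, map_mul, M.ι_phi_pow, hw1,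
            show H - η * j = x + e * ⌊ordinate p (φ i') f j⌋₊ by
              simp only [hn, hy] at h1; omega]
          ring
        · rw [if_pos ⟨rfl, hjT⟩, map_mul, map_mul, map_mul, map_pow, M.ρ_ι, M.ρ_ι, M.ρ_Theta, hw2,
            hsum j a (r j) (hr3 j hjT) (.inl hae), ← hv, ← hV]
          ring
      · simp only [hjT, and_false, if_false]
        by_cases hA0 : reduction p (A i' j) = 0
        · -- The factor `p` of `A i j` raises the order by `e`.
          obtain ⟨A', hA'⟩ := exists_eq_C_mul_of_reduction_eq_zero hA0
          have hle := mul_le_mul_of_nonneg_left (hny j) heR.le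
          obtain ⟨Q, hQ, hQd⟩ := M.exists_representative hd hθ (g := Bi) (m := e * n j) (s := s)
            hj.2 (fun l hl hcase => by
              rcases hcase with ⟨h1, h2⟩ | ⟨h1, h2⟩
              · have h3 := W.lt_of_le_left h2 h1 hl
                have : (e : ℝ) * n j + η * j ≤ e * (devVal p (φ i') f l).toNat + η * l := by
                  linarith
                exact_mod_cast this
              · have h3 := W.le_of_left_lt h2 h1 hl
                have : (e : ℝ) * n j + η * j ≤ e * (devVal p (φ i') f l).toNat + η * l := by
                  linarith
                exact_mod_cast this)
          obtain ⟨w, hw1, hw2⟩ := hzero (g := A i' j * Q) (N := x + e * n j + η * ℓ) (by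
            rw [hA', mul_assoc, map_mul, map_mul, M.ι_prime]
            refine (pow_dvd_pow _ (show _ ≤ e + (e * n j + η * ℓ) by omega)).trans ?_
            rw [pow_add]
            exact mul_dvd_mul_left _ (hQd.mul_left _))
          exact ⟨Q, w, hQ, hw1, hw2⟩
        · -- The fractional part is greater, or `j` is not after the left end of the side. It cannot be
          -- equal with `j` after the right end, because `j₀` is the largest abscissa in question.
          have hjT₁ : j ∈ T₁ := Finset.mem_filter.2 ⟨Finset.mem_Icc.2 hj, hA0⟩
          have hδ := hmin j hjT₁
          have hle : (x : ℝ) + e * n j ≤ e * y j := by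
            have := mul_le_mul_of_nonneg_left hδ heR.le
            linarith
          obtain ⟨Q, hQ, hQd⟩ := M.exists_representative hd hθ (g := Bi) (m := x + e * n j + 1)
            (s := s) hj.2 (fun l hl hcase => by
              suffices (x : ℝ) + e * n j + η * j < e * (devVal p (φ i') f l).toNat + η * l by
                have : x + e * n j + η * j < e * (devVal p (φ i') f l).toNat + η * l := by
                  exact_mod_cast this
                omega
              rcases hcase with ⟨h1, h2⟩ | ⟨h1, h2⟩
              · have h3 := W.lt_of_le_left h2 h1 hl
                linarith
              · have h3 := W.le_of_left_lt h2 h1 hl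
                have h4 : y j₀ - n j₀ < y j - n j := lt_of_le_of_ne hδ fun h4 =>
                  hjT (Finset.mem_filter.2 ⟨hjT₁, h4.symm, h1⟩)
                have := mul_lt_mul_of_pos_left h4 heR
                linarith)
          obtain ⟨w, hw1, hw2⟩ := hzero (g := A i' j * Q) (N := x + e * n j + η * ℓ) (by
            rw [map_mul]
            rw [show x + e * n j + η * ℓ + 1 = x + e * n j + 1 + η * ℓ by ring]
            exact hQd.mul_left _)
          exact ⟨Q, w, hQ, hw1, hw2⟩
    · -- For the other factors the beginning of the development is divisible by a higher power of `p`.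
      simp only [hii, false_and, if_false]
      obtain ⟨b, hb⟩ := Nat.exists_eq_add_of_le hj.2
      set g := φ i ^ ℓ * (φ i' ^ b *
        ∏ i'' ∈ (Finset.univ.erase i).erase i', φ i'' ^ ord p (φ i'') f) with hg
      have hBg : B = φ i' ^ j * g := by
        rw [hB, hBi, ← Finset.mul_prod_erase _ _
          (Finset.mem_erase.2 ⟨hii, Finset.mem_univ i'⟩), hg, hb, pow_add]
        ring
      obtain ⟨Q, hQ, hQd⟩ := M.exists_lower_representative hθ (φ' := φ i') (g := g) (j := j)
        (x := x + e * ⌊ordinate p (φ i') f j⌋₊ + η * ℓ + 1) (fun l hlj hl => by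
          have h1 := floor_ordinate_lt_devVal hf (hφ.monic i') (hφ.irreducible i') hlj hj.2 hl
          have h2 := Nat.mul_le_mul_left e (Nat.succ_le_of_lt h1)
          rw [Nat.succ_eq_add_one, mul_add, mul_one] at h2
          rw [hg, map_mul, map_mul, M.ι_phi_pow]
          refine (pow_dvd_pow _
            (show _ ≤ e * (devVal p (φ i') f l).toNat + η * ℓ by omega)).trans ?_
          rw [pow_add]
          refine mul_dvd_mul_left _ (Dvd.dvd.mul_left ?_ _)
          rw [mul_assoc]
          exact dvd_mul_right _ _)
      rw [← hBg] at hQ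
      obtain ⟨w, hw1, hw2⟩ := hzero (g := A i' j * Q) (by rw [map_mul]; exact hQd.mul_left _)
      exact ⟨Q, w, hQ, hw1, hw2⟩
  set D := x + e * Y + η * ℓ with hD
  have key : ∀ i', ∀ j ∈ Finset.Icc 1 (ord p (φ i') f), ∃ R w,
      aeval θ R = aeval θ B * p ^ Y * (aeval θ (A i' j) * aeval θ (quot (φ i') f j) /
        (p : K) ^ ⌊ordinate p (φ i') f j⌋₊) ∧
      M.ι R = M.ϖ ^ D * w ∧
      M.ρ w = if i' = i ∧ j ∈ T₂ then
        C (AdjoinRoot.mk (reduction p (φ i)) (reduction p (A i j))) *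
          (C v * V ^ (ℓ + a) * (tailPoly c s e d (r j)).comp (V ^ e)) else 0 := by
    intro i' j hj
    obtain ⟨Q, w, hQ, hw1, hw2⟩ := key' i' j hj
    obtain ⟨b, hb⟩ := Nat.exists_eq_add_of_le (hY i' j hj)
    refine ⟨C (p : ℤ) ^ b * (A i' j * Q), w, ?_, ?_, hw2⟩
    · rw [map_mul, map_mul, hQ, hb, map_pow, aeval_C, pow_add]
      simp only [eq_intCast, Int.cast_natCast]
      field_simp
    · rw [map_mul, hw1, M.ι_prime_pow, hD, hb]
      ring
  choose! R w hR1 hR2 hR3 using key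
  have hX : M.ι (∑ i', ∑ j ∈ Finset.Icc 1 (ord p (φ i') f), R i' j) =
      M.ϖ ^ D * ∑ i', ∑ j ∈ Finset.Icc 1 (ord p (φ i') f), w i' j := by
    simp only [map_sum, Finset.mul_sum]
    exact Finset.sum_congr rfl fun i' _ => Finset.sum_congr rfl fun j hj => hR2 i' j hj
  have hρX : M.ρ (∑ i', ∑ j ∈ Finset.Icc 1 (ord p (φ i') f), w i' j) =
      C v * V ^ (ℓ + a) * (∑ j ∈ T₂, C (AdjoinRoot.mk (reduction p (φ i)) (reduction p (A i j))) *
        tailPoly c s e d (r j)).comp (V ^ e) := by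
    simp only [map_sum]
    rw [Finset.sum_eq_single_of_mem i (Finset.mem_univ i)]
    · rw [Finset.sum_congr rfl fun j hj => hR3 i j hj]
      simp only [true_and]
      have hsub : T₂ ⊆ Finset.Icc 1 ℓ := (Finset.filter_subset _ _).trans (Finset.filter_subset _ _)
      rw [Finset.sum_ite_mem, Finset.inter_eq_right.2 hsub, Polynomial.sum_comp, Finset.mul_sum]
      refine Finset.sum_congr rfl fun j _ => ?_
      rw [mul_comp, C_comp]
      ring
    · intro i' _ hii
      refine Finset.sum_eq_zero fun j hj => ?_
      rw [hR3 i' j hj, if_neg (fun h => hii h.1)]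
  have haev : aeval θ (∑ i', ∑ j ∈ Finset.Icc 1 (ord p (φ i') f), R i' j) =
      aeval θ (C (p : ℤ) ^ (Y + 1) * B) * z := by
    simp only [map_sum]
    rw [Finset.sum_congr rfl fun i' _ => Finset.sum_congr rfl fun j hj => hR1 i' j hj]
    simp only [← Finset.mul_sum]
    rw [h]
    simp only [map_mul, map_pow, map_natCast]
    ring
  -- The initial form of `f` is `V ^ s * R (V ^ e)`, with `R` the residual polynomial of the side.
  obtain ⟨F₀, hF1, hF2⟩ := M.exists_ι_quot hd W.le (j := 0) (by omega)
  rw [show quot (φ i) f 0 = f by rw [quot], mul_zero, Nat.sub_zero] at hF1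
  rw [hsum 0 s 0 (by omega) (.inr rfl)] at hF2
  have hc0 : c s ≠ 0 := lineCoeff_ne_zero hφi W.left_ne_top W.left_eq
  have hcd : c (s + e * d) ≠ 0 := by
    rw [← W.eq_add]
    exact lineCoeff_ne_zero hφi W.right_ne_top W.right_eq
  have hR0 : (tailPoly c s e d 0).coeff 0 ≠ 0 := by
    rw [coeff_tailPoly, if_pos (by omega)]
    simpa using hc0
  have hρF : M.ρ F₀ ≠ 0 := by
    rw [hF2]
    have hV0 : V ≠ 0 := mul_ne_zero (C_ne_zero.2 M.c_ne_zero) X_ne_zero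
    refine mul_ne_zero (pow_ne_zero _ hV0) fun h1 => ?_
    rcases comp_eq_zero_iff.1 h1 with h2 | ⟨-, h2⟩
    · rw [h2] at hR0; simp at hR0
    · have h3 : (V ^ e).natDegree = 0 := by rw [h2]; simp
      rw [hV, natDegree_pow, natDegree_C_mul_X _ M.c_ne_zero] at h3
      omega
  have hbound : M.ϖ ^ (D + 1) ∣ M.ι (C (p : ℤ) ^ (Y + 1) * B) := by
    rw [hB, map_mul, map_mul, M.ι_prime_pow, M.ι_phi_pow, ← mul_assoc, ← mul_assoc, ← pow_add,
      mul_assoc]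
    refine (pow_dvd_pow _ ?_).mul_right _
    rw [hD, mul_add]
    omega
  have hfinal := M.residual_dvd_pow (minpoly.monic hz)
    (dvd_eval_scaleRoots hf hfirr hθ (minpoly.monic hz) (minpoly.aeval ℤ z) haev) hF1 hρF hX hbound
  rw [hF2, hρX] at hfinal
  have hres : residualPoly p (φ i) f s τ lam = tailPoly c s e d 0 := by
    have h1 : (τ - s) / e = d := by
      rw [W.eq_add, Nat.add_sub_cancel_left, Nat.mul_div_cancel_left _ hepos]
    rw [residualPoly, tailPoly, ← he, h1, Nat.sub_zero]
    refine Finset.sum_congr rfl fun k hk => ?_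
    have h2 : e * k ≤ e * d := Nat.mul_le_mul_left e (by rw [Finset.mem_range] at hk; omega)
    rw [zero_add, mul_comm k e, hc,
      W.lineCoeff_eq_residualCoeff (by omega) (by rw [W.eq_add]; omega)]
  rw [hres] at hsep
  refine not_tailPoly_dvd_sum hcd ⟨j₀, Finset.mem_filter.2 ⟨hj₀T, rfl, hsj⟩⟩ (fun j hj => ?_)
    (fun j hj => ⟨hr1 j hj, hr2 j hj⟩) ?_
    (dvd_of_comp_dvd_pow M.c_ne_zero hv0 hepos hsep hR0 hfinal)
  · exact mk_reduction_ne_zero hφi (hA i j) (Finset.mem_filter.1 (hT₂mem hj).1).2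
  · intro j hj j' hj' hjj
    have h1 := hr3 j hj
    have h2 := hr3 j' hj'
    rw [hjj] at h1
    omega

end Independence

/-! ### Integrality of the family and integral bases -/

section Integrality

variable {p : ℕ} [Fact p.Prime] {φ f : ℤ[X]}

/-- A valuation that is at most one on the integers in the image of `aeval θ` is at most `v p ^ n`
on `q j (θ)`, for `n` the integral part of the ordinate at `j`. According to whether the value of
`φ θ` lies on one or on the other side of the slope of a supporting line at `j`, this follows from
the end or from the beginning of the development of `f`. -/
lemma valuation_quot_le (hf : f.Monic) (hfirr : Irreducible f) (hφ : φ.Monic)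
    (hirr : Irreducible (reduction p φ)) {K : Type*} [Field K] [CharZero K] {θ : K}
    (hθ : aeval θ f = 0) {Γ : Type*} [LinearOrderedCommGroupWithZero Γ] (v : Valuation K Γ)
    (hv : ∀ g : ℤ[X], v (aeval θ g) ≤ 1) {j : ℕ} (hj : 1 ≤ j) (hjo : j ≤ ord p φ f) :
    v (aeval θ (quot φ f j)) ≤ v p ^ ⌊ordinate p φ f j⌋₊ := by
  obtain ⟨e, h, he, hsupp⟩ := exists_supporting_line hf hfirr hφ hirr hj hjo
  set n := ⌊ordinate p φ f j⌋₊ with hn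
  have hd := degree_pos_of_irreducible_reduction hφ hirr
  have hvp1 : v p ≤ 1 := by simpa using hv (C (p : ℤ))
  have hterm (l m : ℕ) (y : Γ) (hy : devVal p φ f l ≠ ⊤ →
      v p ^ (e * (devVal p φ f l).toNat) * v (aeval θ φ) ^ (e * m) ≤ y ^ e) :
      v (aeval θ (devCoeff φ f l * φ ^ m)) ≤ y := by
    rw [map_mul, map_mul, map_pow, map_pow]
    by_cases h0 : devVal p φ f l = ⊤
    · rw [polyVal_eq_top_iff.1 h0]; simp
    · rw [← pow_le_pow_iff_left₀ zero_le zero_le he.ne']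
      refine le_trans ?_ (hy h0)
      rw [mul_pow, ← pow_mul, mul_comm m e]
      refine mul_le_mul_left ?_ _
      rw [eq_pow_mul_divPow p (devCoeff φ f l), ← devVal, map_mul, map_mul, map_pow, map_pow,
        mul_pow, ← pow_mul, mul_comm _ e]
      have h1 : v (aeval θ (C (p : ℤ))) = v p := by simp
      rw [h1]
      exact mul_le_of_le_one_right' (pow_le_one' (hv _) _)
  rcases le_or_gt (v (aeval θ φ) ^ e) (v p ^ h) with hle | hlt
  · rw [quot_eq_sum hd f j, map_sum]
    refine v.map_sum_le fun l _ => hterm _ _ _ fun hl => ?_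
    have h1 := hsupp _ hl
    rw [mul_add] at h1
    calc _ = v p ^ (e * (devVal p φ f (j + l)).toNat) * (v (aeval θ φ) ^ e) ^ l := by
          rw [← pow_mul]
      _ ≤ v p ^ (e * (devVal p φ f (j + l)).toNat) * (v p ^ h) ^ l :=
          mul_le_mul_right (pow_le_pow_left' hle l) _
      _ = v p ^ (e * (devVal p φ f (j + l)).toNat + h * l) := by rw [pow_add, pow_mul _ h]
      _ ≤ v p ^ (e * n) := pow_le_pow_right_of_le_one' hvp1 (by omega)
      _ = _ := by rw [← pow_mul, mul_comm]
  · have hφ0 : 0 < v (aeval θ φ) := by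
      rw [zero_lt_iff]
      intro h0
      rw [h0, zero_pow he.ne'] at hlt
      exact not_lt_zero hlt
    have hmul : v (aeval θ φ) ^ j * v (aeval θ (quot φ f j)) ≤ v (aeval θ φ) ^ j * v p ^ n := by
      rw [← map_pow, ← map_mul, aeval_pow_mul_quot hθ, map_neg, Valuation.map_neg, map_sum]
      refine v.map_sum_le fun l hl => hterm _ _ _ fun hl0 => ?_
      obtain ⟨r, rfl⟩ := Nat.exists_eq_add_of_le (Finset.mem_range.1 hl).le
      have h1 := hsupp l hl0
      rw [mul_add] at h1
      calc _ ≤ v p ^ (e * n + h * r) * v (aeval θ φ) ^ (e * l) :=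
            mul_le_mul_left (pow_le_pow_right_of_le_one' hvp1 (by omega)) _
        _ = v p ^ (e * n) * (v p ^ h) ^ r * v (aeval θ φ) ^ (e * l) := by rw [pow_add, pow_mul _ h]
        _ ≤ v p ^ (e * n) * (v (aeval θ φ) ^ e) ^ r * v (aeval θ φ) ^ (e * l) :=
            mul_le_mul_left (mul_le_mul_right (pow_le_pow_left' hlt.le r) _) _
        _ = _ := by
            rw [map_pow, mul_pow, ← pow_mul, ← pow_mul, ← pow_mul, mul_assoc, ← pow_add, mul_comm]
            ring_nf
    exact le_of_mul_le_mul_left hmul (pow_pos hφ0 j)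

/-- The members of the family are integral. -/
theorem isIntegral_quot_mul_pow_div (hf : f.Monic) (hfirr : Irreducible f) (hφ : φ.Monic)
    (hirr : Irreducible (reduction p φ)) {K : Type*} [Field K] [NumberField K] {θ : K}
    (hθ : aeval θ f = 0) {j : ℕ} (hj : 1 ≤ j) (hjo : j ≤ ord p φ f) (k : ℕ) :
    IsIntegral ℤ (aeval θ (quot φ f j) * θ ^ k / (p : K) ^ ⌊ordinate p φ f j⌋₊) := by
  have hint : IsIntegral ℤ θ := ⟨f, hf, hθ⟩
  have hp0 : (p : K) ≠ 0 := by exact_mod_cast (Fact.out : p.Prime).ne_zero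
  have hval (v : IsDedekindDomain.HeightOneSpectrum (NumberField.RingOfIntegers K)) (g : ℤ[X]) :
      v.valuation K (aeval θ g) ≤ 1 := by
    obtain ⟨θ', rfl⟩ : ∃ θ' : NumberField.RingOfIntegers K, θ = θ' := ⟨⟨θ, hint⟩, rfl⟩
    have : aeval (θ' : K) g = algebraMap (NumberField.RingOfIntegers K) K (aeval θ' g) :=
      aeval_algebraMap_apply K θ' g
    rw [this]
    exact v.valuation_le_one _
  obtain ⟨x, hx⟩ := IsDedekindDomain.HeightOneSpectrum.mem_integers_of_valuation_le_one K
    (R := NumberField.RingOfIntegers K)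
    (aeval θ (quot φ f j) * θ ^ k / (p : K) ^ ⌊ordinate p φ f j⌋₊) (fun v => by
      have h1 := valuation_quot_le hf hfirr hφ hirr hθ (v.valuation K) (hval v) hj hjo
      have h2 : v.valuation K θ ≤ 1 := by simpa using hval v X
      have h3 : v.valuation K (p : K) ≠ 0 := (Valuation.ne_zero_iff _).2 hp0
      rw [map_div₀, map_mul, map_pow, map_pow]
      refine div_le_one_of_le₀ ?_ zero_le
      exact (mul_le_of_le_one_right' (pow_le_one' h2 k)).trans h1)
  rw [← hx]
  exact x.isIntegral_coe

end Integrality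

section Basis

variable {p : ℕ} [Fact p.Prime] {K : Type*} [Field K] [NumberField K]

/-- A family of integers of `K`, as many as the degree of `K`, is a `p`-integral basis if its
integral combinations lying in `p * Z_K` have coefficients divisible by `p`. -/
theorem isPIntegralBasis_of_forall_dvd {ι : Type*} [Fintype ι] {b : ι → K}
    (hb : ∀ i, IsIntegral ℤ (b i)) (hcard : Fintype.card ι = Module.finrank ℚ K)
    (h : ∀ (c : ι → ℤ) (z : K), IsIntegral ℤ z → ∑ i, (c i : K) * b i = p * z →
      ∀ i, (p : ℤ) ∣ c i) :
    IsPIntegralBasis p b := by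
  have hpp : p.Prime := Fact.out
  have hp0 : (p : K) ≠ 0 := by exact_mod_cast hpp.ne_zero
  -- Dividing by `p` repeatedly: a combination in `p ^ n * Z_K` has coefficients divisible by
  -- `p ^ n`.
  have hpow (n : ℕ) : ∀ (c : ι → ℤ) (z : K), IsIntegral ℤ z →
      ∑ i, (c i : K) * b i = (p : K) ^ n * z →
      ∃ c' : ι → ℤ, (∀ i, c i = (p : ℤ) ^ n * c' i) ∧ ∑ i, (c' i : K) * b i = z := by
    induction n with
    | zero => intro c z _ hc; exact ⟨c, by simp, by simpa using hc⟩
    | succ n ih =>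
      intro c z hz hc
      have hint : IsIntegral ℤ ((p : K) ^ n * z) :=
        ((isIntegral_natCast (R := ℤ) (a := p)).pow n).mul hz
      choose c' hc' using h c _ hint (by rw [hc]; ring)
      obtain ⟨c'', h1, h2⟩ := ih c' z hz (by
        refine mul_left_cancel₀ hp0 ?_
        rw [Finset.mul_sum, ← mul_assoc, ← pow_succ', ← hc]
        refine Finset.sum_congr rfl fun i _ => ?_
        rw [hc' i]; push_cast; ring)
      exact ⟨c'', fun i => by rw [hc' i, h1 i]; ring, h2⟩
  have hlinZ : LinearIndependent ℤ b := by
    rw [Fintype.linearIndependent_iff]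
    intro c hc i
    by_contra hne
    have hfin : FiniteMultiplicity (p : ℤ) (c i) :=
      Int.finiteMultiplicity_iff.2 ⟨by simpa using hpp.ne_one, hne⟩
    obtain ⟨n, hn⟩ := hfin
    obtain ⟨c', h1, -⟩ := hpow (n + 1) c 0 isIntegral_zero (by simpa [zsmul_eq_mul] using hc)
    exact hn ⟨_, h1 i⟩
  have hlinQ : LinearIndependent ℚ b := (LinearIndependent.iff_fractionRing ℤ ℚ).1 hlinZ
  refine ⟨hb, ?_, le_antisymm ?_ ?_⟩
  · exact hlinQ.restrict_scalars (R := localInt p) (by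
      intro x y hxy
      simpa [Subring.smul_def] using hxy)
  · exact Submodule.span_mono (by rintro _ ⟨i, rfl⟩; exact hb i)
  · rw [Submodule.span_le]
    intro x hx
    set B := basisOfLinearIndependentOfCardEqFinrank' b hlinQ hcard with hB
    have hxsum : ∑ i, B.repr x i • b i = x := by
      have := B.sum_repr x
      simpa [hB] using this
    obtain ⟨⟨m, hm⟩, hmc⟩ := IsLocalization.exist_integer_multiples_of_finset
      (nonZeroDivisors ℤ) (Finset.univ.image (B.repr x))
    have hm0 : m ≠ 0 := nonZeroDivisors.ne_zero hm
    have hcm : ∀ i, ∃ c : ℤ, (c : ℚ) = m * B.repr x i := by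
      intro i
      obtain ⟨c, hc⟩ := hmc _ (Finset.mem_image_of_mem _ (Finset.mem_univ i))
      exact ⟨c, by simpa [zsmul_eq_mul] using hc⟩
    choose c hc using hcm
    have hmx : ∑ i, (c i : K) * b i = (m : K) * x := by
      rw [← hxsum, Finset.mul_sum]
      refine Finset.sum_congr rfl fun i _ => ?_
      have h1 : (c i : K) = m * ((B.repr x i : ℚ) : K) := by
        have := congrArg (fun q : ℚ => (q : K)) (hc i)
        push_cast at this
        exact this
      rw [h1, Rat.smul_def, mul_assoc]
    obtain ⟨D, hD, hpD⟩ := (Int.finiteMultiplicity_iff.2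
      ⟨by simpa using hpp.ne_one, hm0⟩ :
        FiniteMultiplicity (p : ℤ) m).exists_eq_pow_mul_and_not_dvd
    have hD0 : D ≠ 0 := fun h0 => hpD (h0 ▸ dvd_zero _)
    obtain ⟨c', -, hc'⟩ := hpow (multiplicity (p : ℤ) m) c (D * x)
      ((isIntegral_intCast (R := ℤ) (n := D)).mul hx) (by
        rw [hmx, ← mul_assoc]
        congr 1
        exact_mod_cast congrArg (fun q : ℤ => (q : K)) hD)
    have hmem (i : ι) : (c' i : ℚ) / D ∈ localInt p := by
      rw [Valuation.mem_integer_iff, map_div₀, Rat.padicValuation_cast, Rat.padicValuation_cast,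
        Int.padicValuation_eq_one_iff.2 hpD, div_one]
      exact Int.padicValuation_le_one p _
    have hDK : (D : K) ≠ 0 := by exact_mod_cast hD0
    have hxe : x = ∑ i, (⟨(c' i : ℚ) / D, hmem i⟩ : localInt p) • b i := by
      refine mul_left_cancel₀ hDK ?_
      rw [← hc', Finset.mul_sum]
      refine Finset.sum_congr rfl fun i _ => ?_
      rw [Subring.smul_def, Rat.smul_def]
      push_cast
      field_simp
    rw [hxe]
    exact Submodule.sum_mem _ fun i _ => Submodule.smul_mem _ _
      (Submodule.subset_span (Set.mem_range_self i))

end Basis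

/-! ### The number of elements of the family -/

section Count

variable {p : ℕ} [Fact p.Prime] {f : ℤ[X]} {t : ℕ} {φ : Fin t → ℤ[X]}

lemma IsFactorLift.reduction_eq_prod (hφ : IsFactorLift p f φ) (hf : f.Monic) :
    reduction p f = ∏ i, reduction p (φ i) ^ ord p (φ i) f := by
  have hdvd : ∏ i, reduction p (φ i) ^ ord p (φ i) f ∣ reduction p f := by
    refine Finset.prod_dvd_of_coprime (fun i _ i' _ hne => ?_) fun i _ => ?_
    · refine IsCoprime.pow ((hφ.irreducible i).coprime_iff_not_dvd.2 fun h => hne ?_)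
      exact hφ.eq_of_dvd h
    · obtain ⟨g, hg, -⟩ := exists_reduction_eq_pow_ord_mul hf (hφ.irreducible i)
      exact ⟨g, hg⟩
  obtain ⟨g, hg⟩ := hdvd
  have hmonic : (∏ i, reduction p (φ i) ^ ord p (φ i) f).Monic :=
    monic_prod_of_monic _ _ fun i _ => ((hφ.monic i).map _).pow _
  have hgm : g.Monic := hmonic.of_mul_monic_left (hg ▸ hf.map _)
  by_cases hu : IsUnit g
  · rw [hg, hgm.eq_one_of_isUnit hu, mul_one]
  · obtain ⟨q, hqm, hqirr, hqg⟩ := exists_monic_irreducible_factor g hu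
    have hmem : q ∈ Set.range fun i => reduction p (φ i) := by
      rw [hφ.range_eq]
      exact ⟨hqm, hqirr, hg ▸ hqg.mul_left _⟩
    obtain ⟨i, rfl⟩ := hmem
    obtain ⟨g', hg', hndvd⟩ := exists_reduction_eq_pow_ord_mul hf (hφ.irreducible i)
    refine absurd ?_ hndvd
    have h1 : reduction p (φ i) ^ ord p (φ i) f * reduction p (φ i) ∣
        reduction p (φ i) ^ ord p (φ i) f * g' := by
      rw [← hg', hg]
      exact mul_dvd_mul (Finset.dvd_prod_of_mem _ (Finset.mem_univ i)) hqg
    exact (mul_dvd_mul_iff_left (pow_ne_zero _ (hφ.irreducible i).ne_zero)).1 h1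

lemma IsFactorLift.natDegree_eq_sum (hφ : IsFactorLift p f φ) (hf : f.Monic) :
    f.natDegree = ∑ i, ord p (φ i) f * (φ i).natDegree := by
  rw [← hf.natDegree_map (Int.castRingHom (ZMod p))]
  change (reduction p f).natDegree = _
  rw [hφ.reduction_eq_prod hf,
    natDegree_prod_of_monic _ _ fun i _ => ((hφ.monic i).map _).pow _]
  refine Finset.sum_congr rfl fun i _ => ?_
  rw [natDegree_pow, (hφ.monic i).natDegree_map]

lemma finrank_eq_natDegree (hf : f.Monic) (hirr : Irreducible f) {K : Type*} [Field K]
    [NumberField K] {θ : K} (hθ : aeval θ f = 0) (hK : IntermediateField.adjoin ℚ {θ} = ⊤) :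
    Module.finrank ℚ K = f.natDegree := by
  have hint : IsIntegral ℤ θ := ⟨f, hf, hθ⟩
  rw [← IntermediateField.finrank_top', ← hK,
    IntermediateField.adjoin.finrank (hint.tower_top (A := ℚ)),
    minpoly.isIntegrallyClosed_eq_field_fractions' ℚ hint, ← eq_minpoly hf hirr hθ,
    hf.natDegree_map]

end Count

end OreNewton

end

/-- Let `f` be a monic irreducible polynomial with integer coefficients, `θ` a root of `f`,
`K = ℚ(θ)`, and `φ 1, …, φ t` monic lifts of the different irreducible factors of `f` modulo `p`.
If `f` is `p`-regular, then the elements `q_{i,j}(θ) θ ^ k / p ^ ⌊y_{i,j}⌋`, `1 ≤ i ≤ t`,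
`1 ≤ j ≤ ℓ_i`, `0 ≤ k < deg φ_i`, form a `p`-integral basis of the ring of integers of `K`. -/
theorem theorem2p5 {p : ℕ} [Fact p.Prime] {f : ℤ[X]} (hf : f.Monic) (hirr : Irreducible f)
    {K : Type*} [Field K] [NumberField K] {θ : K} (hθ : aeval θ f = 0)
    (hK : IntermediateField.adjoin ℚ {θ} = ⊤)
    {t : ℕ} {φ : Fin t → ℤ[X]} (hφ : OreNewton.IsFactorLift p f φ)
    (hreg : OreNewton.IsRegular p f φ) :
    OreNewton.IsPIntegralBasis p
      (fun a : (i : Fin t) × (Finset.Icc 1 (OreNewton.ord p (φ i) f) × Fin (φ i).natDegree) =>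
        aeval θ (OreNewton.quot (φ a.1) f (a.2.1 : ℕ)) * θ ^ (a.2.2 : ℕ) /
          (p : K) ^ ⌊OreNewton.ordinate p (φ a.1) f ((a.2.1 : ℕ) : ℝ)⌋) := by
  have hfloor (i : Fin t) (j : ℕ) : (p : K) ^ ⌊OreNewton.ordinate p (φ i) f j⌋ =
      (p : K) ^ ⌊OreNewton.ordinate p (φ i) f j⌋₊ := by
    rw [← Int.natCast_floor_eq_floor (OreNewton.ordinate_nonneg p (φ i) f j), zpow_natCast]
  simp only [hfloor]
  refine OreNewton.isPIntegralBasis_of_forall_dvd (fun a => ?_) ?_ ?_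
  · have hj := Finset.mem_Icc.1 a.2.1.2
    exact OreNewton.isIntegral_quot_mul_pow_div hf hirr (hφ.monic _) (hφ.irreducible _) hθ hj.1
      hj.2 _
  · rw [OreNewton.finrank_eq_natDegree hf hirr hθ hK, hφ.natDegree_eq_sum hf]
    simp
  · intro c z hz hc
    set A : Fin t → ℕ → ℤ[X] := fun i j =>
      if hj : j ∈ Finset.Icc 1 (OreNewton.ord p (φ i) f) then
        ∑ k : Fin (φ i).natDegree, C (c ⟨i, ⟨j, hj⟩, k⟩) * X ^ (k : ℕ) else 0 with hA
    have hAdeg (i : Fin t) (j : ℕ) : (A i j).degree < (φ i).degree := by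
      have hd : (φ i).degree = (φ i).natDegree := degree_eq_natDegree (hφ.monic i).ne_zero
      simp only [hA]
      split_ifs with hj
      · rw [hd]
        exact degree_sum_fin_lt _
      · rw [degree_zero, hd]
        exact WithBot.bot_lt_coe _
    have hsum : ∑ i, ∑ j ∈ Finset.Icc 1 (OreNewton.ord p (φ i) f),
        aeval θ (A i j) * aeval θ (OreNewton.quot (φ i) f j) /
          (p : K) ^ ⌊OreNewton.ordinate p (φ i) f j⌋₊ = p * z := by
      rw [← hc, Fintype.sum_sigma]
      refine Finset.sum_congr rfl fun i _ => ?_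
      rw [Fintype.sum_prod_type, ← Finset.sum_coe_sort]
      refine Finset.sum_congr rfl fun j _ => ?_
      simp only [hA, dif_pos j.2, map_sum, map_mul, map_pow, aeval_X, map_intCast, Finset.sum_mul,
        Finset.sum_div, eq_intCast]
      refine Finset.sum_congr rfl fun k _ => ?_
      ring
    rintro ⟨i, j, k⟩
    have h1 := OreNewton.reduction_eq_zero_of_isIntegral hf hirr hφ hreg hθ hz hAdeg hsum i j.2
    rw [OreNewton.reduction_eq_zero_iff] at h1
    have h2 := h1 k
    simp only [hA, dif_pos j.2, finsetSum_coeff, coeff_C_mul_X_pow, Fin.val_inj] at h2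
    simpa using h2
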